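/- **Setting.** Fix integers $n,m,d\ge 0$, $T>0$, $x_0\in\mathbb R^n$, $a_0=(a_{0,1},\dots,a_{0,m})\in(\mathbb R^n)^m$, $b_0\in\mathbb R^m$, $K\in\mathbb R$, $U\subset\mathbb R^d$, a mapping $g:\mathbb R^n\times\mathbb R^d\to\mathbb R^n$, a terminal cost $\varphi:\mathbb R^n\to(-\infty,\infty]$ and a running cost $\ell(t,x,a,b,u,\dot x,\dot a,\dot b)\in[-\infty,\infty]$, $t\in[0,T]$. Here $\|\cdot\|$ is the Euclidean norm, and $N(x;C)=\{v:\langle v,y-x\rangle\le 0\ \forall y\in C\}$ if $x\in C$, $N(x;C)=\emptyset$ if $x\notin C$. A pair $(a,b)$ with $a_i\in W^{1,2}([0,T];\mathbb R^n)$ and $b_i\in W^{1,2}([0,T];\mathbb R)$, $i=1,\dots,m$, is called *admissible* if $a(0)=a_0$, $b(0)=b_0$, $\|a_i(t)\|=1$ for all $t\in[0,T]$ and all $i$, and (H2) $\|\dot a_i(t)\|\le K$ and $|\dot b_i(t)|\le K$ for a.e. $t\in[0,T]$ and all $i$. For such a pair put $C(t)=\{x\in\mathbb R^n:\langle a_i(t),x\rangle\le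 b_i(t),\ i=1,\dots,m\}$. Problem $(P)$ is to minimize $$J[x,a,b,u]=\varphi(x(T))+\int_0^T\ell\big(t,x(t),a(t),b(t),u(t),\dot x(t),\dot a(t),\dot b(t)\big)\,dt$$ over all *feasible* quadruples: $x\in W^{1,2}([0,T];\mathbb R^n)$, $(a,b)$ admissible, $u\in L^2([0,T];\mathbb R^d)$, $x(0)=x_0$, $x(t)\in C(t)$ for all $t\in[0,T]$, $u(t)\in U$ and $\dot x(t)\in -N(x(t);C(t))+g(x(t),u(t))$ for a.e. $t\in[0,T]$, and the running cost along the quadruple is integrable on $[0,T]$ (in particular finite a.e.). **Assumptions.** (H1) $U$ is closed and bounded. (H3) There are $L,M>0$ with $\|g(x_1,u_1)-g(x_2,u_2)\|\le L(\|x_1-x_2\|+\|u_1-u_2\|)$ for all $(x_1,u_1),(x_2,u_2)\in\mathbb R^n\times U$, and $\|g(x,u)\|\le M(1+\|x\|)$ for all $(x,u)\in\mathbb R^n\times U$. (H4) For every admissible pair $(a,b)$ there are $v_i\in W^{1,2}([0,T];\mathbb R)$ with $\|a_i(t)-a_i(s)\|\le|v_i(t)-v_i(s)|$ for all $s,t\in[0,T]$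 and $i=1,\dots,m$, and there is a continuous $\vartheta:[0,T]\to\mathbb R$ with $\sup_{[0,T]}\vartheta<0$ such that for every $t\in[0,T]$ some $x\in\mathbb R^n$ satisfies $\langle a_i(t),x\rangle-b_i(t)<\vartheta(t)$ for all $i=1,\dots,m$. (H5) $\varphi$ is lower semicontinuous. There is $c\in\mathbb R$ such that for a.e. $t\in[0,T]$ one has $\ell(t,\cdot)\ge c$, the function $\ell(t,\cdot)$ is lower semicontinuous in all its variables, and for all values of the other variables $\ell$ is continuous in time at $t$ (relative to $[0,T]$). **Theorem 3.1.** Assume (H1)–(H5). Suppose that $\ell$ does not depend on $u$ and that, for a.e. $t$ and all $(x,a,b)$, it is convex as a function of $(\dot x,\dot a,\dot b)$. Suppose furthermore that there is a minimizing sequence of feasible quadruples $(x^k,a^k,b^k,u^k)$, that is, $J[x^k,a^k,b^k,u^k]\to\inf(P)$, such that * there is a summable function $\kappa$ on $[0,T]$ with $\ell\big(t,x^k(t),a^k(t),b^k(t),u^k(t),\dot x^k(t),\dot a^k(t),\dot b^k(t)\big)\le\kappa(t)$ for every $k$ and a.e. $t\in[0,T]$; * $\{(x^k,a^k,b^k)\}$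 is bounded in $W^{1,2}([0,T];\mathbb R^n\times\mathbb R^{mn}\times\mathbb R^m)$; * the set $g(x^k(t),U)=\{g(x^k(t),u):u\in U\}$ is convex for every $k$ and every $t\in[0,T]$. Then $(P)$ has an optimal solution: there is a feasible quadruple $(\bar x,\bar a,\bar b,\bar u)\in W^{1,2}([0,T];\mathbb R^{n+mn+m})\times L^2([0,T];\mathbb R^d)$ with $J[\bar x,\bar a,\bar b,\bar u]\le J[x,a,b,u]$ for every feasible $(x,a,b,u)$. -/

import Mathlib

open MeasureTheory Set Filter Topology
open scoped NNReal ENNReal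

noncomputable section

namespace Sweeping

/-- Euclidean space of dimension `n`. -/
abbrev E (n : ℕ) := EuclideanSpace ℝ (Fin n)

/-- Values `(x, a, b)` of a trajectory together with the controls in the moving set; the same type
is used for the velocities. -/
abbrev State (n m : ℕ) := E n × (Fin m → E n) × (Fin m → ℝ)

/-- Lebesgue measure on `[0, T]`. -/
def leb (T : ℝ) : Measure ℝ := volume.restrict (Icc 0 T)

/-- `f ∈ W^{1,2}([0,T]; F)`: on `[0,T]`, `f` is the integral of a square integrable function
(which then equals the a.e. existing derivative `deriv f` almost everywhere on `[0,T]`). Only the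
values of `f` on `[0,T]` matter. -/
def IsW12 {F : Type*} [NormedAddCommGroup F] [NormedSpace ℝ F] (T : ℝ) (f : ℝ → F) : Prop :=
  ∃ v : ℝ → F, MemLp v 2 (leb T) ∧ ∀ t ∈ Icc (0 : ℝ) T, f t = f 0 + ∫ s in (0 : ℝ)..t, v s

/-- The norm of `W^{1,2}([0,T]; F)` (for functions of that space). -/
def w12Norm {F : Type*} [NormedAddCommGroup F] [NormedSpace ℝ F] (T : ℝ) (f : ℝ → F) : ℝ≥0∞ :=
  eLpNorm f 2 (leb T) + eLpNorm (deriv f) 2 (leb T)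

/-- The normal cone of convex analysis to `C` at `x`; it is empty when `x ∉ C`. -/
def normalCone {n : ℕ} (x : E n) (C : Set (E n)) : Set (E n) :=
  {ζ | x ∈ C ∧ ∀ y ∈ C, inner ℝ ζ (y - x) ≤ 0}

/-- The polyhedron `{x | ⟨a i, x⟩ ≤ b i for all i}`. -/
def polyhedron {n m : ℕ} (a : Fin m → E n) (b : Fin m → ℝ) : Set (E n) :=
  {x | ∀ i, inner ℝ (a i) x ≤ b i}

/-- The data of an optimal control problem for a controlled sweeping process. -/
structure Problem (n m d : ℕ) where
  /-- final time -/
  T : ℝ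
  /-- initial state -/
  x₀ : E n
  /-- initial values of the controls `a` -/
  a₀ : Fin m → E n
  /-- initial values of the controls `b` -/
  b₀ : Fin m → ℝ
  /-- uniform bound for the velocities of the controls `a` and `b` -/
  K : ℝ
  /-- control set of the perturbation -/
  U : Set (E d)
  /-- perturbation mapping -/
  g : E n → E d → E n
  /-- terminal cost -/
  φ : E n → EReal
  /-- running cost `ℓ(t, (x, a, b), u, (ẋ, ȧ, ḃ))` -/
  ℓ : ℝ → State n m → E d → State n m → EReal

/-- A quadruple `(x, a, b, u)` of functions of time. -/
structure Quadruple (n m d : ℕ) where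
  /-- trajectory -/
  x : ℝ → E n
  /-- normals of the moving polyhedron -/
  a : Fin m → ℝ → E n
  /-- right-hand sides of the moving polyhedron -/
  b : Fin m → ℝ → ℝ
  /-- control in the perturbation -/
  u : ℝ → E d

namespace Quadruple

variable {n m d : ℕ}

/-- The point `(x(t), a(t), b(t))`. -/
def pos (q : Quadruple n m d) (t : ℝ) : State n m :=
  (q.x t, fun i => q.a i t, fun i => q.b i t)

/-- The velocity `(ẋ(t), ȧ(t), ḃ(t))`. -/
def vel (q : Quadruple n m d) (t : ℝ) : State n m :=
  (deriv q.x t, fun i => deriv (q.a i) t, fun i => deriv (q.b i) t)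

/-- The moving set `C(t)`. -/
def C (q : Quadruple n m d) (t : ℝ) : Set (E n) :=
  polyhedron (fun i => q.a i t) (fun i => q.b i t)

end Quadruple

namespace Problem

variable {n m d : ℕ}

/-- Admissible controls in the moving set: `W^{1,2}` functions with the prescribed initial values,
with velocities bounded by `K` and with unit normals `a i`. -/
structure AdmissibleControls (P : Problem n m d) (a : Fin m → ℝ → E n) (b : Fin m → ℝ → ℝ) :
    Prop where
  a_w12 : ∀ i, IsW12 P.T (a i)
  b_w12 : ∀ i, IsW12 P.T (b i)
  a_init : ∀ i, a i 0 = P.a₀ i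
  b_init : ∀ i, b i 0 = P.b₀ i
  a_bound : ∀ i, ∀ᵐ t ∂(leb P.T), ‖deriv (a i) t‖ ≤ P.K
  b_bound : ∀ i, ∀ᵐ t ∂(leb P.T), ‖deriv (b i) t‖ ≤ P.K
  a_unit : ∀ i, ∀ t ∈ Icc (0 : ℝ) P.T, ‖a i t‖ = 1

/-- The running cost along a quadruple, as a function of time. -/
def runningCost (P : Problem n m d) (q : Quadruple n m d) (t : ℝ) : EReal :=
  P.ℓ t (q.pos t) (q.u t) (q.vel t)

/-- Feasible solutions. The running cost is integrable: finite almost everywhere, with an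
integrable real part. -/
structure Feasible (P : Problem n m d) (q : Quadruple n m d) : Prop where
  x_w12 : IsW12 P.T q.x
  controls : P.AdmissibleControls q.a q.b
  u_l2 : MemLp q.u 2 (leb P.T)
  u_mem : ∀ᵐ t ∂(leb P.T), q.u t ∈ P.U
  x_init : q.x 0 = P.x₀
  x_mem : ∀ t ∈ Icc (0 : ℝ) P.T, q.x t ∈ q.C t
  inclusion : ∀ᵐ t ∂(leb P.T), ∃ ζ ∈ normalCone (q.x t) (q.C t),
    deriv q.x t = -ζ + P.g (q.x t) (q.u t)
  cost_finite : ∀ᵐ t ∂(leb P.T), P.runningCost q t ≠ ⊤ ∧ P.runningCost q t ≠ ⊥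
  cost_integrable : Integrable (fun t => (P.runningCost q t).toReal) (leb P.T)

/-- The cost functional `J`, to be used for feasible solutions. -/
def J (P : Problem n m d) (q : Quadruple n m d) : EReal :=
  P.φ (q.x P.T) + ((∫ t, (P.runningCost q t).toReal ∂(leb P.T) : ℝ) : EReal)

/-- The optimal value of the problem. -/
def value (P : Problem n m d) : EReal := ⨅ q : {q : Quadruple n m d // P.Feasible q}, P.J q

/-- Optimal solutions (global minimizers among the feasible solutions). -/
def IsOptimal (P : Problem n m d) (q : Quadruple n m d) : Prop :=
  P.Feasible q ∧ ∀ q', P.Feasible q' → P.J q ≤ P.J q'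

/-- Minimizing sequences of feasible solutions. -/
def IsMinimizingSeq (P : Problem n m d) (q : ℕ → Quadruple n m d) : Prop :=
  (∀ k, P.Feasible (q k)) ∧ Tendsto (fun k => P.J (q k)) atTop (𝓝 P.value)

/-- The control set is closed and bounded. -/
def H1 (P : Problem n m d) : Prop := IsClosed P.U ∧ Bornology.IsBounded P.U

/-- Lipschitz continuity and sublinear growth of the perturbation mapping. -/
def H3 (P : Problem n m d) : Prop :=
  (∃ L : ℝ, 0 < L ∧ ∀ x₁ x₂ : E n, ∀ u₁ ∈ P.U, ∀ u₂ ∈ P.U,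
    ‖P.g x₁ u₁ - P.g x₂ u₂‖ ≤ L * (‖x₁ - x₂‖ + ‖u₁ - u₂‖)) ∧
  (∃ M : ℝ, 0 < M ∧ ∀ x : E n, ∀ u ∈ P.U, ‖P.g x u‖ ≤ M * (1 + ‖x‖))

/-- The condition on the moving set, imposed on every admissible control pair `(a, b)`: variation
of `a` controlled by `W^{1,2}` functions, and the Slater-type condition. -/
def H4 (P : Problem n m d) : Prop :=
  ∀ a b, P.AdmissibleControls a b →
    (∃ v : Fin m → ℝ → ℝ, (∀ i, IsW12 P.T (v i)) ∧
      ∀ i, ∀ s ∈ Icc (0 : ℝ) P.T, ∀ t ∈ Icc (0 : ℝ) P.T, ‖a i t - a i s‖ ≤ |v i t - v i s|) ∧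
    (∃ θ : ℝ → ℝ, ContinuousOn θ (Icc 0 P.T) ∧ (∃ δ < 0, ∀ t ∈ Icc (0 : ℝ) P.T, θ t ≤ δ) ∧
      ∀ t ∈ Icc (0 : ℝ) P.T, ∃ x : E n, ∀ i, inner ℝ (a i t) x - b i t < θ t)

/-- The terminal cost has values in `(-∞, ∞]` and is l.s.c.; for a.e. `t`, the running cost is
bounded from below, l.s.c. in all its other variables, and continuous in time at `t`. -/
def H5 (P : Problem n m d) : Prop :=
  (∀ x, P.φ x ≠ ⊥) ∧ LowerSemicontinuous P.φ ∧
  (∃ c : ℝ, ∀ᵐ t ∂(leb P.T), ∀ y u w, (c : EReal) ≤ P.ℓ t y u w) ∧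
  (∀ᵐ t ∂(leb P.T), LowerSemicontinuous
    (fun p : State n m × E d × State n m => P.ℓ t p.1 p.2.1 p.2.2)) ∧
  (∀ᵐ t ∂(leb P.T), ∀ y u w, ContinuousWithinAt (fun s => P.ℓ s y u w) (Icc 0 P.T) t)

/-- The running cost does not depend on `u`. -/
def CostIndepControl (P : Problem n m d) : Prop :=
  ∀ t ∈ Icc (0 : ℝ) P.T, ∀ y u u' w, P.ℓ t y u w = P.ℓ t y u' w

/-- The running cost is convex (as an extended-real-valued function: its epigraph is convex) in the
velocity variables. -/
def CostConvexVel (P : Problem n m d) : Prop :=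
  ∀ᵐ t ∂(leb P.T), ∀ y u, Convex ℝ {p : State n m × ℝ | P.ℓ t y u p.1 ≤ (p.2 : EReal)}

end Problem

end Sweeping

end

/-! The velocities `(ẋ, ȧ, ḃ)` and the perturbations `g(x, u)` along a minimizing sequence are
bounded in `L²`, so by Mazur's lemma convex combinations of their tails converge in `L²` and, after
passing to a subsequence, almost everywhere, while the states `(x, a, b)` themselves converge
uniformly. By Fatou's lemma, at almost every time the averages of the squared norms stay bounded
along a subsequence, so the velocities are uniformly integrable with respect to the weights of the
averages there. This permits passing to the limit in constraints `(yₖ, wₖ) ∈ Γ` with `Γ` closed and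
convex in the second variable, and, by approximating with affine minorants, in lower semicontinuous
integrands that are convex in the velocity. Slater's condition closes the graph of the normal cone
of the moving polyhedron, and a measurable selection recovers a control from the limit
perturbation. -/

namespace Sweeping

/-! ### Averages over the tails of a sequence -/

section TailAverages

/-- `p N` is, for every `N`, a system of finitely many weights on the indices `j ≥ N`. The weights
are taken in `ℝ≥0` so that they act on real vector spaces and on `ℝ≥0∞` alike. -/
structure IsTailWeights (p : ℕ → ℕ →₀ ℝ≥0) : Prop where
  sum_eq_one : ∀ N, ∑ j ∈ (p N).support, p N j = 1
  le_of_mem : ∀ N, ∀ j ∈ (p N).support, N ≤ j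

/-- The average of the sequence `z` with respect to the weights `p N`, a convex combination of the
tail `z N, z (N + 1), …` if `p` are tail weights. -/
def tailAvg {F : Type*} [AddCommMonoid F] [Module ℝ≥0 F] (p : ℕ → ℕ →₀ ℝ≥0) (z : ℕ → F) (N : ℕ) :
    F :=
  ∑ j ∈ (p N).support, p N j • z j

namespace IsTailWeights

variable {p : ℕ → ℕ →₀ ℝ≥0}

theorem comp_of_le (hp : IsTailWeights p) {σ : ℕ → ℕ} (hσ : ∀ N, N ≤ σ N) :
    IsTailWeights (p ∘ σ) :=
  ⟨fun N => hp.sum_eq_one (σ N), fun N j hj => (hσ N).trans (hp.le_of_mem (σ N) j hj)⟩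

theorem tailAvg_const {F : Type*} [AddCommMonoid F] [Module ℝ≥0 F] (hp : IsTailWeights p) (c : F)
    (N : ℕ) : tailAvg p (fun _ => c) N = c := by
  rw [tailAvg, ← Finset.sum_smul, hp.sum_eq_one, one_smul]

theorem tailAvg_mem {F : Type*} [AddCommGroup F] [Module ℝ F] (hp : IsTailWeights p) {S : Set F}
    (hS : Convex ℝ S) {z : ℕ → F} {N : ℕ} (hz : ∀ j, N ≤ j → z j ∈ S) : tailAvg p z N ∈ S :=
  hS.sum_mem (fun _ _ => NNReal.coe_nonneg _) (mod_cast hp.sum_eq_one N)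
    fun j hj => hz j (hp.le_of_mem N j hj)

theorem eventually_tailAvg_mem {F : Type*} [AddCommGroup F] [Module ℝ F] (hp : IsTailWeights p)
    {S : Set F} (hS : Convex ℝ S) {z : ℕ → F} (hz : ∀ᶠ j in atTop, z j ∈ S) :
    ∀ᶠ N in atTop, tailAvg p z N ∈ S := by
  obtain ⟨N₀, hN₀⟩ := eventually_atTop.1 hz
  exact eventually_atTop.2 ⟨N₀, fun N hN => hp.tailAvg_mem hS fun j hj => hN₀ j (hN.trans hj)⟩

theorem tendsto_tailAvg {F : Type*} [NormedAddCommGroup F] [NormedSpace ℝ F]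
    (hp : IsTailWeights p) {z : ℕ → F} {l : F} (hz : Tendsto z atTop (𝓝 l)) :
    Tendsto (tailAvg p z) atTop (𝓝 l) := by
  rw [Metric.tendsto_nhds] at hz ⊢
  exact fun ε hε => hp.eventually_tailAvg_mem (convex_ball l ε) (hz ε hε)

theorem eventually_tailAvg_le_tailAvg (hp : IsTailWeights p) {f g : ℕ → ℝ≥0∞}
    (h : ∀ᶠ j in atTop, f j ≤ g j) : ∀ᶠ N in atTop, tailAvg p f N ≤ tailAvg p g N := by
  obtain ⟨N₀, hN₀⟩ := eventually_atTop.1 h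
  refine eventually_atTop.2 ⟨N₀, fun N hN => Finset.sum_le_sum fun j hj => ?_⟩
  gcongr
  exact hN₀ j (hN.trans (hp.le_of_mem N j hj))

end IsTailWeights

variable {p : ℕ → ℕ →₀ ℝ≥0}

theorem map_tailAvg {F G : Type*} [AddCommGroup F] [Module ℝ F] [AddCommGroup G] [Module ℝ G]
    (A : F →ₗ[ℝ] G) (z : ℕ → F) (N : ℕ) :
    A (tailAvg p z N) = tailAvg p (fun j => A (z j)) N := by
  simp only [tailAvg, map_sum, NNReal.smul_def, map_smul]

theorem fst_tailAvg {F G : Type*} [AddCommGroup F] [Module ℝ F] [AddCommGroup G] [Module ℝ G]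
    (z : ℕ → F × G) (N : ℕ) : (tailAvg p z N).1 = tailAvg p (fun j => (z j).1) N :=
  map_tailAvg (LinearMap.fst ℝ F G) z N

theorem tailAvg_add {F : Type*} [AddCommMonoid F] [Module ℝ≥0 F] (z w : ℕ → F) (N : ℕ) :
    tailAvg p (fun j => z j + w j) N = tailAvg p z N + tailAvg p w N := by
  simp only [tailAvg, smul_add, Finset.sum_add_distrib]

theorem ofReal_tailAvg_le (z : ℕ → ℝ) (N : ℕ) :
    ENNReal.ofReal (tailAvg p z N) ≤ tailAvg p (fun j => ENNReal.ofReal (z j)) N := by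
  refine (Finset.le_sum_of_subadditive ENNReal.ofReal ENNReal.ofReal_zero.le
    (fun _ _ => ENNReal.ofReal_add_le) _ _).trans_eq (Finset.sum_congr rfl fun j _ => ?_)
  rw [NNReal.smul_def, smul_eq_mul, ENNReal.ofReal_mul (NNReal.coe_nonneg _),
    ENNReal.ofReal_coe_nnreal, ENNReal.smul_def, smul_eq_mul]

theorem lintegral_tailAvg {Ω : Type*} [MeasurableSpace Ω] {μ : Measure Ω} {f : ℕ → Ω → ℝ≥0∞}
    (hf : ∀ j, AEMeasurable (f j) μ) (N : ℕ) :
    ∫⁻ t, tailAvg p (fun j => f j t) N ∂μ = tailAvg p (fun j => ∫⁻ t, f j t ∂μ) N := by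
  simp only [tailAvg, ENNReal.smul_def, smul_eq_mul]
  rw [lintegral_finsetSum' _ fun j _ => (hf j).const_mul _]
  exact Finset.sum_congr rfl fun j _ => lintegral_const_mul'' _ (hf j)

theorem aemeasurable_tailAvg {Ω : Type*} [MeasurableSpace Ω] {μ : Measure Ω} {f : ℕ → Ω → ℝ≥0∞}
    (hf : ∀ j, AEMeasurable (f j) μ) (N : ℕ) :
    AEMeasurable (fun t => tailAvg p (fun j => f j t) N) μ := by
  simp only [tailAvg, ENNReal.smul_def, smul_eq_mul]
  exact Finset.aemeasurable_fun_sum _ fun j _ => (hf j).const_mul _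

theorem aestronglyMeasurable_tailAvg {Ω F : Type*} [MeasurableSpace Ω] {μ : Measure Ω}
    [NormedAddCommGroup F] [NormedSpace ℝ F] {f : ℕ → Ω → F}
    (hf : ∀ j, AEStronglyMeasurable (f j) μ) (N : ℕ) :
    AEStronglyMeasurable (fun t => tailAvg p (fun j => f j t) N) μ :=
  Finset.aestronglyMeasurable_fun_sum _ fun j _ => (hf j).const_smul _

end TailAverages

/-! ### Mazur's lemma -/

section Mazur

theorem exists_weights_of_mem_convexHull {F : Type*} [AddCommGroup F] [Module ℝ F] {z : ℕ → F}
    {N : ℕ} {x : F} (hx : x ∈ convexHull ℝ (z '' Ici N)) :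
    ∃ w : ℕ →₀ ℝ≥0, ∑ j ∈ w.support, w j = 1 ∧ (∀ j ∈ w.support, N ≤ j) ∧
      ∑ j ∈ w.support, w j • z j = x := by
  obtain ⟨ι, t, w, y, hw, hw1, hy, rfl⟩ := (convexHull_eq (R := ℝ) (z '' Ici N)).subset hx
  choose! k hk hkz using hy
  refine ⟨∑ i ∈ t, Finsupp.single (k i) (w i).toNNReal, ?_, fun j hj => ?_, ?_⟩
  · change Finsupp.sum _ (fun _ c => c) = 1
    rw [← Finsupp.sum_finsetSum_index (fun _ => rfl) (fun _ _ _ => rfl)]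
    simp only [Finsupp.sum_single_index]
    rw [← Real.toNNReal_sum_of_nonneg hw, hw1, Real.toNNReal_one]
  · obtain ⟨i, hi, hij⟩ := Finset.mem_biUnion.1 (Finsupp.support_finsetSum hj)
    obtain rfl := Finset.mem_singleton.1 (Finsupp.support_single_subset hij)
    exact hk i hi
  · change Finsupp.sum _ (fun j c => c • z j) = _
    rw [← Finsupp.sum_finsetSum_index (h := fun j (c : ℝ≥0) => c • z j)
      (fun _ => zero_smul _ _) (fun _ _ _ => add_smul _ _ _), Finset.centerMass_eq_of_sum_1 _ _ hw1]
    refine Finset.sum_congr rfl fun i hi => ?_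
    rw [Finsupp.sum_single_index (h := fun j (c : ℝ≥0) => c • z j) (zero_smul _ _),
      NNReal.smul_def, Real.coe_toNNReal _ (hw i hi), hkz i hi]

variable {H : Type*} [NormedAddCommGroup H] [InnerProductSpace ℝ H] [CompleteSpace H]

theorem exists_norm_sub_sq_le {K : Set H} (hne : K.Nonempty) (hcl : IsClosed K)
    (hconv : Convex ℝ K) : ∃ v ∈ K, ∀ w ∈ K, ‖w - v‖ ^ 2 ≤ ‖w‖ ^ 2 - ‖v‖ ^ 2 := by
  obtain ⟨v, hv, hmin⟩ := exists_norm_eq_iInf_of_complete_convex hne hcl.isComplete hconv 0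
  refine ⟨v, hv, fun w hw => ?_⟩
  have hobtuse := (norm_eq_iInf_iff_real_inner_le_zero hconv hv).1 hmin w hw
  have hexpand := norm_add_sq_real (w - v) v
  rw [zero_sub, inner_neg_left, real_inner_comm] at hobtuse
  rw [sub_add_cancel] at hexpand
  linarith

theorem exists_tendsto_of_antitone_convex {K : ℕ → Set H} (hanti : Antitone K)
    (hcl : ∀ N, IsClosed (K N)) (hconv : ∀ N, Convex ℝ (K N)) {z : ℕ → H} (hz : ∀ N, z N ∈ K N)
    {R : ℝ} (hR : ∀ N, ‖z N‖ ≤ R) :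
    ∃ v : ℕ → H, (∀ N, v N ∈ K N) ∧ ∃ l, Tendsto v atTop (𝓝 l) := by
  choose v hv hmin using fun N => exists_norm_sub_sq_le ⟨z N, hz N⟩ (hcl N) (hconv N)
  have hsq {N M : ℕ} (h : N ≤ M) : ‖v M - v N‖ ^ 2 ≤ ‖v M‖ ^ 2 - ‖v N‖ ^ 2 :=
    hmin N _ (hanti h (hv M))
  have hmono : Monotone fun N => ‖v N‖ ^ 2 := fun N M h =>
    sub_nonneg.1 ((sq_nonneg _).trans (hsq h))
  have hbdd : BddAbove (range fun N => ‖v N‖ ^ 2) := by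
    refine ⟨R ^ 2, forall_mem_range.2 fun N => ?_⟩
    exact (sub_nonneg.1 ((sq_nonneg _).trans (hmin N _ (hz N)))).trans
      (pow_le_pow_left₀ (norm_nonneg _) (hR N) 2)
  have hcauchy : CauchySeq v := by
    have hc := (tendsto_atTop_ciSup hmono hbdd).cauchySeq
    rw [Metric.cauchySeq_iff'] at hc ⊢
    intro ε hε
    obtain ⟨N, hN⟩ := hc (ε ^ 2) (by positivity)
    refine ⟨N, fun M hM => ?_⟩
    rw [dist_eq_norm]
    exact lt_of_pow_lt_pow_left₀ 2 hε.le ((hsq hM).trans_lt (abs_lt.1 (hN M hM)).2)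
  exact ⟨v, hv, cauchySeq_tendsto_of_complete hcauchy⟩

theorem exists_tendsto_tailAvg {z : ℕ → H} {R : ℝ} (hR : ∀ k, ‖z k‖ ≤ R) :
    ∃ p, IsTailWeights p ∧ ∃ l, Tendsto (tailAvg p z) atTop (𝓝 l) := by
  obtain ⟨v, hv, l, hl⟩ := exists_tendsto_of_antitone_convex (z := z) (R := R)
    (K := fun N => closure (convexHull ℝ (z '' Ici N)))
    (fun N M h => closure_mono (convexHull_mono (image_mono (Ici_subset_Ici.2 h))))
    (fun N => isClosed_closure) (fun N => (convex_convexHull ℝ _).closure)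
    (fun N => subset_closure (subset_convexHull ℝ _ (mem_image_of_mem z self_mem_Ici))) hR
  have happrox (N : ℕ) : ∃ w : ℕ →₀ ℝ≥0, ∑ j ∈ w.support, w j = 1 ∧
      (∀ j ∈ w.support, N ≤ j) ∧ dist (∑ j ∈ w.support, w j • z j) (v N) ≤ 1 / (N + 1 : ℝ) := by
    obtain ⟨y, hy, hd⟩ := Metric.mem_closure_iff.1 (hv N) (1 / (N + 1 : ℝ)) (by positivity)
    obtain ⟨w, hw, hwN, rfl⟩ := exists_weights_of_mem_convexHull hy
    exact ⟨w, hw, hwN, by rw [dist_comm]; exact hd.le⟩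
  choose p hp hpN hpv using happrox
  refine ⟨p, ⟨hp, hpN⟩, l, (tendsto_iff_of_dist ?_).2 hl⟩
  exact squeeze_zero (fun _ => dist_nonneg) hpv tendsto_one_div_add_atTop_nhds_zero_nat

variable {Ω : Type*} [MeasurableSpace Ω] {μ : Measure Ω}

theorem toLp_tailAvg_ae_eq {F : Type*} [NormedAddCommGroup F] [NormedSpace ℝ F]
    {p : ℕ → ℕ →₀ ℝ≥0} {f : ℕ → Ω → F} (hf : ∀ k, MemLp (f k) 2 μ) (N : ℕ) :
    ⇑(tailAvg p (fun j => (hf j).toLp) N) =ᵐ[μ] fun t => tailAvg p (fun j => f j t) N := by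
  simp only [tailAvg, NNReal.smul_def]
  refine (Lp.coeFn_finsetSum _ _).trans ?_
  have hsmul (j : ℕ) : ⇑((p N j : ℝ) • (hf j).toLp) =ᵐ[μ] fun t => (p N j : ℝ) • f j t := by
    filter_upwards [Lp.coeFn_smul (p N j : ℝ) (hf j).toLp, (hf j).coeFn_toLp] with t h1 h2
    rw [h1, Pi.smul_apply, h2]
  filter_upwards [ae_all_iff.2 hsmul] with t ht
  simp only [Finset.sum_apply, ht]

theorem exists_tailAvg_tendsto_eLpNorm_of_hilbert {f : ℕ → Ω → H} (hf : ∀ k, MemLp (f k) 2 μ)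
    {R : ℝ≥0} (hR : ∀ k, eLpNorm (f k) 2 μ ≤ R) :
    ∃ p, IsTailWeights p ∧ ∃ v : Ω → H, MemLp v 2 μ ∧
      Tendsto (fun N => eLpNorm (fun t => tailAvg p (fun j => f j t) N - v t) 2 μ) atTop (𝓝 0) := by
  have hnorm (k : ℕ) : ‖(hf k).toLp‖ ≤ R := by
    rw [Lp.norm_toLp]
    exact ENNReal.toReal_le_coe_of_le_coe (hR k)
  obtain ⟨p, hp, l, hl⟩ := exists_tendsto_tailAvg hnorm
  refine ⟨p, hp, l, Lp.memLp l, ((Lp.tendsto_Lp_iff_tendsto_eLpNorm' _ _).1 hl).congr fun N => ?_⟩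
  exact eLpNorm_congr_ae ((toLp_tailAvg_ae_eq hf N).sub (ae_eq_refl l))

/-- `toEuclidean` reduces the finite-dimensional case to the Hilbert space `L²`. -/
theorem exists_tailAvg_tendsto_eLpNorm {F : Type*} [NormedAddCommGroup F] [NormedSpace ℝ F]
    [FiniteDimensional ℝ F] {f : ℕ → Ω → F} (hf : ∀ k, MemLp (f k) 2 μ) {R : ℝ≥0}
    (hR : ∀ k, eLpNorm (f k) 2 μ ≤ R) :
    ∃ p, IsTailWeights p ∧ ∃ v : Ω → F, MemLp v 2 μ ∧
      Tendsto (fun N => eLpNorm (fun t => tailAvg p (fun j => f j t) N - v t) 2 μ) atTop (𝓝 0) := by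
  set e := toEuclidean (E := F)
  have hbound (k : ℕ) : eLpNorm (fun t => e (f k t)) 2 μ ≤
      (‖e.toContinuousLinearMap‖₊ * R : ℝ≥0) := by
    refine (eLpNorm_le_nnreal_smul_eLpNorm_of_ae_le_mul (.of_forall fun t =>
      e.toContinuousLinearMap.le_opNNNorm (f k t)) 2).trans ?_
    rw [ENNReal.smul_def, smul_eq_mul, ENNReal.coe_mul]
    gcongr
    exact hR k
  obtain ⟨p, hp, v, hv, hlim⟩ := exists_tailAvg_tendsto_eLpNorm_of_hilbert
    (fun k => e.toContinuousLinearMap.comp_memLp' (hf k)) hbound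
  refine ⟨p, hp, fun t => e.symm (v t), e.symm.toContinuousLinearMap.comp_memLp' hv, ?_⟩
  have hlim' := ENNReal.Tendsto.const_mul (a := (‖e.symm.toContinuousLinearMap‖₊ : ℝ≥0∞)) hlim
    (Or.inr ENNReal.coe_ne_top)
  rw [mul_zero] at hlim'
  refine tendsto_of_tendsto_of_tendsto_of_le_of_le tendsto_const_nhds hlim' (fun _ => zero_le)
    fun N => ?_
  refine (eLpNorm_le_nnreal_smul_eLpNorm_of_ae_le_mul (.of_forall fun t => ?_) 2)
  convert! e.symm.toContinuousLinearMap.le_opNNNorm _ using 3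
  have h := map_tailAvg (p := p) e.toLinearMap (fun j => f j t) N
  simp only [ContinuousLinearEquiv.coe_toLinearEquiv, LinearEquiv.coe_coe] at h
  simp [← h]

theorem exists_tailAvg_tendsto_ae {F : Type*} [NormedAddCommGroup F] [NormedSpace ℝ F]
    [FiniteDimensional ℝ F] {f : ℕ → Ω → F} (hf : ∀ k, MemLp (f k) 2 μ) {R : ℝ≥0}
    (hR : ∀ k, eLpNorm (f k) 2 μ ≤ R) :
    ∃ p, IsTailWeights p ∧ ∃ v : Ω → F, MemLp v 2 μ ∧
      Tendsto (fun N => eLpNorm (fun t => tailAvg p (fun j => f j t) N - v t) 2 μ) atTop (𝓝 0) ∧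
      ∀ᵐ t ∂μ, Tendsto (tailAvg p fun j => f j t) atTop (𝓝 (v t)) := by
  obtain ⟨p, hp, v, hv, hlim⟩ := exists_tailAvg_tendsto_eLpNorm hf hR
  obtain ⟨σ, hσ, hae⟩ := (tendstoInMeasure_of_tendsto_eLpNorm (by norm_num)
    (fun N => aestronglyMeasurable_tailAvg (fun j => (hf j).1) N) hv.1 hlim).exists_seq_tendsto_ae
  exact ⟨p ∘ σ, hp.comp_of_le hσ.id_le, v, hv, hlim.comp hσ.tendsto_atTop, hae⟩

end Mazur

/-! ### Measurable selections -/

section Selection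

variable {Ω X : Type*} [MeasurableSpace Ω]

theorem measurableSet_exists_nonpos [TopologicalSpace X] [CompactSpace X]
    [TopologicalSpace.SeparableSpace X] {h : Ω → X → ℝ} (hm : ∀ c, Measurable fun ω => h ω c)
    (hc : ∀ ω, Continuous (h ω)) : MeasurableSet {ω | ∃ c, h ω c ≤ 0} := by
  obtain ⟨D, hDc, hD⟩ := TopologicalSpace.exists_countable_dense X
  suffices heq : {ω | ∃ c, h ω c ≤ 0} = ⋂ n : ℕ, ⋃ c ∈ D, {ω | h ω c < 1 / ((n : ℝ) + 1)} by
    rw [heq]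
    exact .iInter fun n => .biUnion hDc fun c _ => measurableSet_lt (hm c) measurable_const
  ext ω
  simp only [mem_ofPred_eq, mem_iInter, mem_iUnion, exists_prop]
  constructor
  · rintro ⟨c, hz⟩ n
    obtain ⟨x, hx, hxD⟩ := hD.inter_open_nonempty {x : X | h ω x < 1 / ((n : ℝ) + 1)}
      (isOpen_lt (hc ω) continuous_const) ⟨c, hz.trans_lt (by positivity)⟩
    exact ⟨x, hxD, hx⟩
  · intro H
    have : Nonempty X := (H 0).nonempty
    obtain ⟨c, -, hmin⟩ := isCompact_univ.exists_isMinOn univ_nonempty (hc ω).continuousOn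
    refine ⟨c, le_of_forall_pos_lt_add fun ε hε => ?_⟩
    obtain ⟨n, hn⟩ := exists_nat_one_div_lt hε
    obtain ⟨x, -, hx⟩ := H n
    linarith [isMinOn_iff.1 hmin x (mem_univ x)]

/-- The smallest point of the sublevel set depends measurably on the parameter. -/
theorem exists_measurable_nonpos_of_real {S : Set ℝ} (hS : IsCompact S) {h : Ω → S → ℝ}
    (hm : ∀ c, Measurable fun ω => h ω c) (hc : ∀ ω, Continuous (h ω))
    (hz : ∀ ω, ∃ c, h ω c ≤ 0) : ∃ u : Ω → S, Measurable u ∧ ∀ ω, h ω (u ω) ≤ 0 := by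
  have : CompactSpace S := isCompact_iff_compactSpace.1 hS
  choose u hu hleast using fun ω =>
    (isClosed_le (hc ω) continuous_const).isCompact.exists_isLeast (hz ω)
  refine ⟨u, Measurable.subtype_mk (f := fun ω => (u ω : ℝ)) (measurable_of_Iic fun r => ?_), hu⟩
  have hF : IsClosed {c : S | (c : ℝ) ≤ r} := isClosed_le continuous_subtype_val continuous_const
  have : CompactSpace {c : S | (c : ℝ) ≤ r} := isCompact_iff_compactSpace.1 hF.isCompact
  convert measurableSet_exists_nonpos (h := fun ω (c : {c : S | (c : ℝ) ≤ r}) => h ω c)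
    (fun c => hm c) (fun ω => (hc ω).comp continuous_subtype_val) using 1
  ext ω
  exact ⟨fun hr => ⟨⟨u ω, hr⟩, hu ω⟩,
    fun ⟨c, hc⟩ => (Subtype.coe_le_coe.2 (hleast ω hc)).trans c.2⟩

/-- A compact metrizable space is a continuous image of the Cantor set. -/
theorem exists_measurable_nonpos [TopologicalSpace X] [CompactSpace X]
    [TopologicalSpace.MetrizableSpace X] [Nonempty X] [MeasurableSpace X] [BorelSpace X]
    {h : Ω → X → ℝ} (hm : ∀ c, Measurable fun ω => h ω c) (hc : ∀ ω, Continuous (h ω)) :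
    ∃ u : Ω → X, Measurable u ∧ ∀ ω, (∃ c, h ω c ≤ 0) → h ω (u ω) ≤ 0 := by
  classical
  let := TopologicalSpace.metrizableSpaceMetric X
  obtain ⟨f, hf, hfs⟩ := exists_nat_bool_continuous_surjective_of_compact X
  set σ : cantorSet → X := f ∘ cantorSetHomeomorphNatToBool
  have hσ : Continuous σ := hf.comp (Homeomorph.continuous _)
  have hσs : Function.Surjective σ := hfs.comp (Homeomorph.surjective _)
  set Z := {ω | ∃ c, h ω c ≤ 0}
  have hZ : MeasurableSet Z := measurableSet_exists_nonpos hm hc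
  obtain ⟨u, hu, hu0⟩ := exists_measurable_nonpos_of_real isCompact_cantorSet
    (h := fun ω r => Z.indicator (fun ω => h ω (σ r)) ω) (fun r => (hm _).indicator hZ)
    (fun ω => by
      by_cases hω : ω ∈ Z
      · simpa only [indicator_of_mem hω, Function.comp_def] using (hc ω).comp hσ
      · simpa only [indicator_of_notMem hω] using continuous_const)
    (fun ω => by
      by_cases hω : ω ∈ Z
      · obtain ⟨c, hcz⟩ := id hω
        obtain ⟨r, rfl⟩ := hσs c
        exact ⟨r, (indicator_of_mem hω _).trans_le hcz⟩
      · exact ⟨⟨0, zero_mem_cantorSet⟩, (indicator_of_notMem hω _).le⟩)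
  refine ⟨σ ∘ u, hσ.measurable.comp hu, fun ω hω => ?_⟩
  have h0 := hu0 ω
  rwa [indicator_of_mem (s := Z) hω] at h0

/-- Filippov's lemma. -/
theorem exists_measurable_selection_of_mem_image {Y Z : Type*} {μ : Measure Ω}
    [TopologicalSpace X] [TopologicalSpace.MetrizableSpace X] [MeasurableSpace X] [BorelSpace X]
    [Nonempty X] [MeasurableSpace Y] [MetricSpace Z] [SecondCountableTopology Z] [MeasurableSpace Z]
    [BorelSpace Z] {U : Set X} (hU : IsCompact U) {g : Y → X → Z}
    (hg : ∀ u ∈ U, Measurable fun y => g y u) (hgc : ∀ y, ContinuousOn (g y) U)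
    {y : Ω → Y} (hy : AEMeasurable y μ) {γ : Ω → Z} (hγ : AEMeasurable γ μ)
    (hmem : ∀ᵐ t ∂μ, γ t ∈ g (y t) '' U) :
    ∃ u : Ω → X, Measurable u ∧ ∀ᵐ t ∂μ, u t ∈ U ∧ g (y t) (u t) = γ t := by
  rcases U.eq_empty_or_nonempty with rfl | hne
  · simp only [image_empty, mem_empty_iff_false] at hmem
    exact ⟨fun _ => Classical.arbitrary X, measurable_const, hmem.mono fun _ => False.elim⟩
  have : CompactSpace U := isCompact_iff_compactSpace.1 hU
  have : Nonempty U := hne.to_subtype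
  obtain ⟨u, hu, hu0⟩ := exists_measurable_nonpos
    (h := fun t (c : U) => dist (g (hy.mk y t) c) (hγ.mk γ t))
    (fun c => ((hg c c.2).comp hy.measurable_mk).dist hγ.measurable_mk)
    (fun t => (continuousOn_iff_continuous_domRestrict.1 (hgc _)).dist continuous_const)
  refine ⟨fun t => u t, measurable_subtype_coe.comp hu, ?_⟩
  filter_upwards [hmem, hy.ae_eq_mk, hγ.ae_eq_mk] with t ⟨c, hcU, hc⟩ hyt hγt
  refine ⟨(u t).2, ?_⟩
  rw [hyt, hγt] at hc ⊢
  exact dist_le_zero.1 (hu0 t ⟨⟨c, hcU⟩, (dist_eq_zero.2 hc).le⟩)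

end Selection

/-! ### Convex integrands along convergent averages -/

section ConvexIntegrands

section AffineMinorant

variable {W : Type*} [NormedAddCommGroup W] [NormedSpace ℝ W]

theorem exists_separating_affine {S : Set (W × ℝ)} (hconv : Convex ℝ S) (hcl : IsClosed S)
    (hne : S.Nonempty) (hup : ∀ w ρ ρ', (w, ρ) ∈ S → ρ ≤ ρ' → (w, ρ') ∈ S) {w₀ : W} {β : ℝ}
    (h₀ : (w₀, β) ∉ S) :
    ∃ (A : W →L[ℝ] ℝ) (k s : ℝ), 0 ≤ k ∧ A w₀ + k * β < s ∧
      ∀ w ρ, (w, ρ) ∈ S → s < A w + k * ρ := by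
  obtain ⟨F, s, hF₀, hF⟩ := geometric_hahn_banach_point_closed hconv hcl h₀
  have hsplit (w : W) (ρ : ℝ) : F (w, ρ) = F (w, 0) + F (0, 1) * ρ := by
    rw [mul_comm, ← smul_eq_mul, ← map_smul, ← map_add]
    simp
  have hS (w : W) (ρ : ℝ) (h : (w, ρ) ∈ S) : s < F (w, 0) + F (0, 1) * ρ := hsplit w ρ ▸ hF _ h
  refine ⟨F.comp (ContinuousLinearMap.inl ℝ W ℝ), F (0, 1), s, ?_, hsplit w₀ β ▸ hF₀, hS⟩
  by_contra! hk
  obtain ⟨⟨w, ρ⟩, hw⟩ := hne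
  have hlt := hS w _ (hup w ρ _ hw (le_max_left ρ ((s - F (w, 0)) / F (0, 1))))
  have hle := mul_le_mul_of_nonpos_left (le_max_right ρ ((s - F (w, 0)) / F (0, 1))) hk.le
  rw [mul_div_cancel₀ _ hk.ne] at hle
  linarith

theorem exists_affine_lt_of_convex_epigraph {f : W → EReal} (hf : LowerSemicontinuous f)
    (hconv : Convex ℝ {p : W × ℝ | f p.1 ≤ (p.2 : EReal)}) {c : ℝ} (hc : ∀ w, (c : EReal) ≤ f w)
    {w₀ : W} {β : ℝ} (hβ : (β : EReal) < f w₀) :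
    ∃ (A : W →L[ℝ] ℝ) (r : ℝ), (∀ w, ((A w + r : ℝ) : EReal) < f w) ∧ β < A w₀ + r := by
  obtain ⟨β', hββ', hβ'⟩ := EReal.lt_iff_exists_real_btwn.1 hβ
  have hββ : β < β' := EReal.coe_lt_coe_iff.1 hββ'
  rcases {p : W × ℝ | f p.1 ≤ (p.2 : EReal)}.eq_empty_or_nonempty with hemp | hne
  · refine ⟨0, β', fun w => lt_of_not_ge fun h => ?_, by simpa using hββ⟩
    exact hemp.subset
      (show (w, (0 : W →L[ℝ] ℝ) w + β') ∈ {p : W × ℝ | f p.1 ≤ (p.2 : EReal)} from h)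
  have hcl : IsClosed {p : W × ℝ | f p.1 ≤ (p.2 : EReal)} := hf.isClosed_epigraph.preimage
    (continuous_fst.prodMk (continuous_coe_real_ereal.comp continuous_snd))
  obtain ⟨p, k, s, hk, hβs, hs⟩ := exists_separating_affine hconv hcl hne
    (fun w ρ ρ' h hρ => le_trans h (EReal.coe_le_coe_iff.2 hρ)) (not_le.2 hβ')
  -- A vertical hyperplane has to be tilted, which the lower bound `c` of `f` allows.
  rcases hk.eq_or_lt with rfl | hk
  · simp only [zero_mul, add_zero] at hs hβs
    set M : ℝ := (|β - c| + 1) / (s - p w₀)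
    have hM : M * (s - p w₀) = |β - c| + 1 := div_mul_cancel₀ _ (by linarith)
    have hM0 : 0 < M := div_pos (by positivity) (by linarith)
    refine ⟨-(M • p), M * s + c, fun w => lt_of_not_ge fun h => ?_, ?_⟩
    · have hw := hs w _ h
      have hcw := EReal.coe_le_coe_iff.1 ((hc w).trans h)
      simp only [neg_apply, smul_apply, smul_eq_mul] at hcw
      nlinarith
    · simp only [neg_apply, smul_apply, smul_eq_mul]
      linarith [le_abs_self (β - c)]
  · have hscale (w : W) : k * ((-(k⁻¹ • p)) w + k⁻¹ * s) = s - p w := by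
      simp only [neg_apply, smul_apply, smul_eq_mul]
      field_simp
      ring
    refine ⟨-(k⁻¹ • p), k⁻¹ * s, fun w => lt_of_not_ge fun h => ?_, ?_⟩
    · linarith [hs w _ h, hscale w]
    · exact hββ.trans (lt_of_mul_lt_mul_left (by linarith [hscale w₀]) hk.le)

end AffineMinorant

section SquareIntegrable

variable {Ω W : Type*} [MeasurableSpace Ω] {μ : Measure Ω} [NormedAddCommGroup W]

theorem lintegral_enorm_sq_le {w : Ω → W} {R : ℝ≥0} (hR : eLpNorm w 2 μ ≤ R) :
    ∫⁻ t, ‖w t‖ₑ ^ 2 ∂μ ≤ R ^ 2 := by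
  have h := eLpNorm_nnreal_pow_eq_lintegral (f := w) (μ := μ) (p := 2) two_ne_zero
  simp only [NNReal.coe_ofNat, ENNReal.rpow_ofNat, ENNReal.coe_ofNat] at h
  exact h ▸ pow_le_pow_left₀ zero_le hR 2

theorem ae_liminf_tailAvg_lt_top {w : ℕ → Ω → W} {p : ℕ → ℕ →₀ ℝ≥0} (hp : IsTailWeights p)
    (hwm : ∀ j, AEStronglyMeasurable (w j) μ) {R : ℝ≥0} (hR : ∀ j, eLpNorm (w j) 2 μ ≤ R) :
    ∀ᵐ t ∂μ, liminf (tailAvg p fun j => ‖w j t‖ₑ ^ 2) atTop < ⊤ := by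
  have hm (j : ℕ) : AEMeasurable (fun t => ‖w j t‖ₑ ^ 2) μ := (hwm j).enorm.pow_const 2
  have hlm : AEMeasurable (fun t => liminf (tailAvg p fun j => ‖w j t‖ₑ ^ 2) atTop) μ := by
    simp only [liminf_eq_iSup_iInf_of_nat]
    exact .iSup fun _ => .biInf _ (to_countable _) fun N _ => aemeasurable_tailAvg hm N
  refine ae_lt_top' hlm ?_
  refine ne_top_of_le_ne_top (ENNReal.pow_ne_top ENNReal.coe_ne_top (n := 2)) (b := R ^ 2) ?_
  refine (lintegral_liminf_le' fun N => aemeasurable_tailAvg hm N).trans ?_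
  refine liminf_le_of_frequently_le' (Eventually.frequently ?_)
  filter_upwards [hp.eventually_tailAvg_le_tailAvg
    (.of_forall fun j => lintegral_enorm_sq_le (hR j))] with N hN
  rwa [lintegral_tailAvg hm, ← hp.tailAvg_const ((R : ℝ≥0∞) ^ 2) N]

end SquareIntegrable

variable {Y W : Type*} [TopologicalSpace Y] [NormedAddCommGroup W] [NormedSpace ℝ W]
  [FiniteDimensional ℝ W]

/-- On bounded sets of `w` this is compactness; for large `w` the quadratic term dominates. -/
theorem eventually_affine_le {f : Y × W → ℝ≥0∞} {y₀ : Y}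
    (hf : ∀ w, LowerSemicontinuousAt f (y₀, w)) {A : W →L[ℝ] ℝ} {r : ℝ}
    (hA : ∀ w, ((A w + r : ℝ) : EReal) < f (y₀, w)) {ε : ℝ≥0} (hε : 0 < ε) :
    ∀ᶠ y in 𝓝 y₀, ∀ w, ENNReal.ofReal (A w + r) ≤ f (y, w) + ε * ‖w‖ₑ ^ 2 := by
  have := FiniteDimensional.proper ℝ W
  set B : ℝ := max 1 ((‖A‖ + |r|) / ε)
  have hball : ∀ᶠ y in 𝓝 y₀, ∀ w ∈ Metric.closedBall (0 : W) B,
      ENNReal.ofReal (A w + r) ≤ f (y, w) := by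
    refine (isCompact_closedBall (0 : W) B).eventually_forall_of_forall_eventually
      (P := fun y w => ENNReal.ofReal (A w + r) ≤ f (y, w)) fun w _ => ?_
    have hcont : ContinuousAt (fun z : Y × W => A z.2 + r) (y₀, w) := by fun_prop
    rcases lt_or_ge (A w + r) 0 with hneg | hpos
    · filter_upwards [hcont.eventually_lt_const hneg] with z hz
      exact (ENNReal.ofReal_of_nonpos hz.le).trans_le zero_le
    · have hlt : ENNReal.ofReal (A w + r) < f (y₀, w) := by
        rw [← EReal.coe_ennreal_lt_coe_ennreal_iff, EReal.coe_ennreal_ofReal, max_eq_left hpos]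
        exact hA w
      obtain ⟨ρ, hρ, hρf⟩ := exists_between hlt
      have hcont' := (ENNReal.continuous_ofReal.continuousAt.comp hcont).eventually_lt_const hρ
      filter_upwards [hf w ρ hρf, hcont'] with z hz hz'
      exact (hz'.trans hz).le
  filter_upwards [hball] with y hy w
  by_cases hw : w ∈ Metric.closedBall (0 : W) B
  · exact (hy w hw).trans le_self_add
  have hBw : B < ‖w‖ := by simpa only [mem_closedBall_zero_iff, not_le] using hw
  have hw1 : 1 ≤ ‖w‖ := (le_max_left _ _).trans hBw.le
  have hw2 : ‖A‖ + |r| ≤ ‖w‖ * ε := by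
    rw [← div_le_iff₀ (NNReal.coe_pos.2 hε)]
    exact (le_max_right _ _).trans hBw.le
  refine le_add_left ?_
  rw [← ofReal_norm, ← ENNReal.ofReal_coe_nnreal, ← ENNReal.ofReal_pow (norm_nonneg w),
    ← ENNReal.ofReal_mul (NNReal.coe_nonneg ε)]
  refine ENNReal.ofReal_le_ofReal ?_
  calc A w + r ≤ ‖A‖ * ‖w‖ + |r| * ‖w‖ := add_le_add ((le_abs_self _).trans (A.le_opNorm w))
        ((le_abs_self r).trans (le_mul_of_one_le_right (abs_nonneg r) hw1))
    _ = (‖A‖ + |r|) * ‖w‖ := by ring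
    _ ≤ ‖w‖ * ε * ‖w‖ := by gcongr
    _ = ε * ‖w‖ ^ 2 := by ring

theorem le_liminf_tailAvg {f : Y × W → ℝ≥0∞} {y : ℕ → Y} {y₀ : Y} {w : ℕ → W} {w₀ : W}
    {p : ℕ → ℕ →₀ ℝ≥0} (hp : IsTailWeights p) (hf : ∀ w, LowerSemicontinuousAt f (y₀, w))
    (hconv : Convex ℝ {p : W × ℝ | (f (y₀, p.1) : EReal) ≤ p.2}) (hy : Tendsto y atTop (𝓝 y₀))
    (hw : Tendsto (tailAvg p w) atTop (𝓝 w₀)) {ε : ℝ≥0} (hε : 0 < ε) :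
    f (y₀, w₀) ≤ liminf (tailAvg p fun j => f (y j, w j) + ε * ‖w j‖ₑ ^ 2) atTop := by
  refine ENNReal.le_of_forall_nnreal_lt fun β hβ => ?_
  have hlsc : LowerSemicontinuous fun w => (f (y₀, w) : EReal) := fun w =>
    continuous_coe_ennreal_ereal.continuousAt.comp_lowerSemicontinuousAt
      ((hf w).comp (g := fun w => (y₀, w)) (by fun_prop)) EReal.coe_ennreal_strictMono.monotone
  obtain ⟨A, r, hA, hAβ⟩ := exists_affine_lt_of_convex_epigraph hlsc hconv (c := 0)
    (fun w => EReal.coe_ennreal_nonneg _) (w₀ := w₀) (β := β)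
    (EReal.coe_ennreal_lt_coe_ennreal_iff.2 hβ)
  have hminorant := hp.eventually_tailAvg_le_tailAvg (f := fun j => ENNReal.ofReal (A (w j) + r))
    ((hy.eventually (eventually_affine_le hf hA hε)).mono fun j hj => hj (w j))
  have havg (N : ℕ) : A (tailAvg p w N) + r = tailAvg p (fun j => A (w j) + r) N := by
    rw [tailAvg_add, hp.tailAvg_const]
    exact congrArg (· + r) (map_tailAvg A.toLinearMap w N)
  have hlim : Tendsto (fun N => A (tailAvg p w N) + r) atTop (𝓝 (A w₀ + r)) :=
    ((A.continuous.tendsto w₀).comp hw).add_const r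
  refine le_liminf_of_le (by isBoundedDefault) ?_
  filter_upwards [hlim.eventually_const_lt hAβ, hminorant] with N hN hle
  rw [← ENNReal.ofReal_coe_nnreal]
  exact (ENNReal.ofReal_le_ofReal (hN.le.trans_eq (havg N))).trans
    ((ofReal_tailAvg_le _ N).trans hle)

/-- `le_liminf_tailAvg` for the integrand with the values `0` on `Γ` and `⊤` elsewhere. -/
theorem mem_of_tendsto_tailAvg {Γ : Set (Y × W)} {y : ℕ → Y} {y₀ : Y} {w : ℕ → W} {w₀ : W}
    {p : ℕ → ℕ →₀ ℝ≥0} (hp : IsTailWeights p) (hΓ : ∀ w, (y₀, w) ∈ closure Γ → (y₀, w) ∈ Γ)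
    (hconv : Convex ℝ {w | (y₀, w) ∈ Γ}) (hy : Tendsto y atTop (𝓝 y₀))
    (hw : Tendsto (tailAvg p w) atTop (𝓝 w₀)) (hmem : ∀ j, (y j, w j) ∈ Γ)
    (hbdd : liminf (tailAvg p fun j => ‖w j‖ₑ ^ 2) atTop < ⊤) : (y₀, w₀) ∈ Γ := by
  classical
  set f : Y × W → ℝ≥0∞ := fun z => if z ∈ Γ then 0 else ⊤
  have hlsc (w : W) : LowerSemicontinuousAt f (y₀, w) := fun β hβ => by
    have hnot : (y₀, w) ∉ closure Γ := fun h => by simp [f, hΓ w h] at hβ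
    filter_upwards [isClosed_closure.isOpen_compl.mem_nhds hnot] with z hz
    simpa only [f, if_neg fun h => hz (subset_closure h)] using hβ.trans_le le_top
  have hepi : {p : W × ℝ | (f (y₀, p.1) : EReal) ≤ p.2} = {w | (y₀, w) ∈ Γ} ×ˢ Ici 0 := by
    ext ⟨w, ρ⟩
    by_cases h : (y₀, w) ∈ Γ <;> simp [f, h]
  have hle := le_liminf_tailAvg hp hlsc (hepi ▸ hconv.prod (convex_Ici 0)) hy hw one_pos
  simp only [f, hmem, if_true, zero_add, ENNReal.coe_one, one_mul] at hle
  by_contra h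
  exact (hle.trans_lt hbdd).ne (if_neg h)

variable {Ω : Type*} [MeasurableSpace Ω] {μ : Measure Ω}

theorem lintegral_le_of_tendsto_tailAvg {f : Ω → Y × W → ℝ≥0∞} {y : ℕ → Ω → Y} {y₀ : Ω → Y}
    {w : ℕ → Ω → W} {w₀ : Ω → W} {p : ℕ → ℕ →₀ ℝ≥0} (hp : IsTailWeights p)
    (hf : ∀ᵐ t ∂μ, ∀ w, LowerSemicontinuousAt (f t) (y₀ t, w))
    (hconv : ∀ᵐ t ∂μ, Convex ℝ {p : W × ℝ | (f t (y₀ t, p.1) : EReal) ≤ p.2})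
    (hy : ∀ᵐ t ∂μ, Tendsto (fun j => y j t) atTop (𝓝 (y₀ t)))
    (hw : ∀ᵐ t ∂μ, Tendsto (tailAvg p fun j => w j t) atTop (𝓝 (w₀ t)))
    (hfm : ∀ j, AEMeasurable (fun t => f t (y j t, w j t)) μ)
    (hwm : ∀ j, AEStronglyMeasurable (w j) μ) {R : ℝ≥0} (hR : ∀ j, eLpNorm (w j) 2 μ ≤ R)
    {I : ℝ≥0∞} (hI : ∀ᶠ j in atTop, ∫⁻ t, f t (y j t, w j t) ∂μ ≤ I) :
    ∫⁻ t, f t (y₀ t, w₀ t) ∂μ ≤ I := by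
  refine ENNReal.le_of_forall_pos_le_add fun δ hδ _ => ?_
  obtain ⟨ε, hε, hεδ⟩ := ENNReal.exists_nnreal_pos_mul_lt
    (ENNReal.pow_ne_top (ENNReal.coe_ne_top (r := R)) (n := 2)) (ENNReal.coe_pos.2 hδ).ne'
  have hgm (j : ℕ) : AEMeasurable (fun t => f t (y j t, w j t) + ε * ‖w j t‖ₑ ^ 2) μ :=
    (hfm j).add (((hwm j).enorm.pow_const 2).const_mul _)
  have hg : ∀ᶠ j in atTop, ∫⁻ t, f t (y j t, w j t) + ε * ‖w j t‖ₑ ^ 2 ∂μ ≤ I + δ := by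
    filter_upwards [hI] with j hj
    rw [lintegral_add_left' (hfm j), lintegral_const_mul'' _ ((hwm j).enorm.pow_const 2)]
    refine add_le_add hj (le_trans ?_ hεδ.le)
    gcongr
    exact lintegral_enorm_sq_le (hR j)
  calc ∫⁻ t, f t (y₀ t, w₀ t) ∂μ
      ≤ ∫⁻ t, liminf (tailAvg p fun j => f t (y j t, w j t) + ε * ‖w j t‖ₑ ^ 2) atTop ∂μ := by
        refine lintegral_mono_ae ?_
        filter_upwards [hf, hconv, hy, hw] with t h1 h2 h3 h4
        exact le_liminf_tailAvg hp h1 h2 h3 h4 hε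
    _ ≤ liminf (fun N => ∫⁻ t, tailAvg p (fun j => f t (y j t, w j t) + ε * ‖w j t‖ₑ ^ 2) N ∂μ)
          atTop := lintegral_liminf_le' fun N => aemeasurable_tailAvg hgm N
    _ ≤ I + δ := by
        refine liminf_le_of_frequently_le' (Eventually.frequently ?_)
        filter_upwards [hp.eventually_tailAvg_le_tailAvg hg] with N hN
        rwa [lintegral_tailAvg hgm, ← hp.tailAvg_const (I + δ) N]

end ConvexIntegrands

/-! ### Extended-real-valued integrands -/

section ExtendedIntegrands

theorem toENNReal_sub_le_iff {x : EReal} {c : ℝ} {ρ : ℝ≥0∞} :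
    (x - c).toENNReal ≤ ρ ↔ x ≤ ρ + c := by
  rw [← EReal.coe_ennreal_le_coe_ennreal_iff, EReal.coe_toENNReal_eq_max, max_le_iff,
    EReal.sub_le_iff_le_add (.inl (EReal.coe_ne_bot c)) (.inl (EReal.coe_ne_top c))]
  exact and_iff_right (EReal.coe_ennreal_nonneg ρ)

theorem lowerSemicontinuous_toENNReal_sub {Z : Type*} [TopologicalSpace Z] {f : Z → EReal}
    (hf : LowerSemicontinuous f) (c : ℝ) :
    LowerSemicontinuous fun z => (f z - c).toENNReal := by
  refine lowerSemicontinuous_iff_isClosed_preimage.2 fun ρ => ?_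
  simpa only [preimage, mem_Iic, toENNReal_sub_le_iff] using hf.isClosed_preimage (ρ + c)

theorem convex_epigraph_toENNReal_sub {W : Type*} [AddCommGroup W] [Module ℝ W] {f : W → EReal}
    (hf : Convex ℝ {p : W × ℝ | f p.1 ≤ (p.2 : EReal)}) (c : ℝ) :
    Convex ℝ {p : W × ℝ | ((f p.1 - c).toENNReal : EReal) ≤ p.2} := by
  have hepi : {p : W × ℝ | ((f p.1 - c).toENNReal : EReal) ≤ p.2} =
      Prod.snd ⁻¹' Ici 0 ∩ (· + ((0 : W), c)) ⁻¹' {p | f p.1 ≤ (p.2 : EReal)} := by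
    ext p
    simp only [EReal.coe_toENNReal_eq_max, max_le_iff, mem_ofPred_eq, mem_inter_iff, mem_preimage,
      mem_Ici, Prod.fst_add, Prod.snd_add, add_zero, EReal.coe_add, EReal.coe_nonneg,
      EReal.sub_le_iff_le_add (.inl (EReal.coe_ne_bot c)) (.inl (EReal.coe_ne_top c))]
  rw [hepi]
  exact ((convex_Ici 0).linear_preimage (LinearMap.snd ℝ W ℝ)).inter
    (hf.translate_preimage_left _)

variable {Ω : Type*} [MeasurableSpace Ω] {μ : Measure Ω} [IsFiniteMeasure μ]

theorem lintegral_toENNReal_sub {h : Ω → EReal} {c : ℝ} (hc : ∀ᵐ t ∂μ, (c : EReal) ≤ h t)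
    (hfin : ∀ᵐ t ∂μ, h t ≠ ⊤ ∧ h t ≠ ⊥) (hint : Integrable (fun t => (h t).toReal) μ) :
    ∫⁻ t, (h t - c).toENNReal ∂μ = ENNReal.ofReal (∫ t, (h t).toReal ∂μ - c * μ.real univ) := by
  have heq : (fun t => (h t - c).toENNReal) =ᵐ[μ] fun t => ENNReal.ofReal ((h t).toReal - c) := by
    filter_upwards [hfin] with t ht
    lift h t to ℝ using ht with x
    rw [← EReal.coe_sub, EReal.real_coe_toENNReal, EReal.toReal_coe]
  have hnonneg : 0 ≤ᵐ[μ] fun t => (h t).toReal - c := by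
    filter_upwards [hfin, hc] with t ht hct
    lift h t to ℝ using ht with x
    simpa using hct
  rw [lintegral_congr_ae heq, ← ofReal_integral_eq_lintegral_ofReal
    (f := fun t => (h t).toReal - c) (hint.sub (integrable_const c)) hnonneg,
    integral_sub hint (integrable_const c), integral_const, smul_eq_mul, mul_comm]

theorem integrable_toReal_of_lintegral_toENNReal_sub_ne_top {h : Ω → EReal} {c : ℝ}
    (hm : AEMeasurable h μ) (hc : ∀ᵐ t ∂μ, (c : EReal) ≤ h t)
    (htop : ∫⁻ t, (h t - c).toENNReal ∂μ ≠ ⊤) :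
    (∀ᵐ t ∂μ, h t ≠ ⊤ ∧ h t ≠ ⊥) ∧ Integrable (fun t => (h t).toReal) μ := by
  have hgm : AEMeasurable (fun t => (h t - c).toENNReal) μ := (hm.sub_const _).ereal_toENNReal
  have hfin : ∀ᵐ t ∂μ, h t ≠ ⊤ ∧ h t ≠ ⊥ := by
    filter_upwards [ae_lt_top' hgm htop, hc] with t ht hct
    refine ⟨fun h' => ?_, (EReal.bot_lt_coe c |>.trans_le hct).ne'⟩
    simp [h'] at ht
  refine ⟨hfin, ((integrable_toReal_of_lintegral_ne_top hgm htop).add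
    (integrable_const c)).congr ?_⟩
  filter_upwards [hfin, hc] with t ht hct
  rw [Pi.add_apply]
  lift h t to ℝ using ht with x
  have hx : 0 ≤ x - c := sub_nonneg.2 (EReal.coe_le_coe_iff.1 hct)
  rw [← EReal.coe_sub, EReal.real_coe_toENNReal, ENNReal.toReal_ofReal hx, EReal.toReal_coe,
    sub_add_cancel]

variable {Y W : Type*} [TopologicalSpace Y] [NormedAddCommGroup W] [NormedSpace ℝ W]
  [FiniteDimensional ℝ W]

theorem integral_le_of_tendsto_tailAvg {f : Ω → Y × W → EReal} {y : ℕ → Ω → Y} {y₀ : Ω → Y}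
    {w : ℕ → Ω → W} {w₀ : Ω → W} {p : ℕ → ℕ →₀ ℝ≥0} (hp : IsTailWeights p)
    (hf : ∀ᵐ t ∂μ, LowerSemicontinuous (f t)) {c : ℝ} (hc : ∀ᵐ t ∂μ, ∀ z, (c : EReal) ≤ f t z)
    (hconv : ∀ᵐ t ∂μ, Convex ℝ {p : W × ℝ | f t (y₀ t, p.1) ≤ (p.2 : EReal)})
    (hy : ∀ᵐ t ∂μ, Tendsto (fun j => y j t) atTop (𝓝 (y₀ t)))
    (hw : ∀ᵐ t ∂μ, Tendsto (tailAvg p fun j => w j t) atTop (𝓝 (w₀ t)))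
    (hfm : ∀ j, AEMeasurable (fun t => f t (y j t, w j t)) μ)
    (hf₀m : AEMeasurable (fun t => f t (y₀ t, w₀ t)) μ)
    (hwm : ∀ j, AEStronglyMeasurable (w j) μ) {R : ℝ≥0} (hR : ∀ j, eLpNorm (w j) 2 μ ≤ R)
    (hfin : ∀ j, ∀ᵐ t ∂μ, f t (y j t, w j t) ≠ ⊤ ∧ f t (y j t, w j t) ≠ ⊥)
    (hint : ∀ j, Integrable (fun t => (f t (y j t, w j t)).toReal) μ) {I : ℝ}
    (hI : ∀ᶠ j in atTop, ∫ t, (f t (y j t, w j t)).toReal ∂μ ≤ I) :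
    (∀ᵐ t ∂μ, f t (y₀ t, w₀ t) ≠ ⊤ ∧ f t (y₀ t, w₀ t) ≠ ⊥) ∧
      Integrable (fun t => (f t (y₀ t, w₀ t)).toReal) μ ∧
      ∫ t, (f t (y₀ t, w₀ t)).toReal ∂μ ≤ I := by
  have hcy (j : ℕ) : ∀ᵐ t ∂μ, (c : EReal) ≤ f t (y j t, w j t) := hc.mono fun t h => h _
  have hcy₀ : ∀ᵐ t ∂μ, (c : EReal) ≤ f t (y₀ t, w₀ t) := hc.mono fun t h => h _
  have hle : ∫⁻ t, (f t (y₀ t, w₀ t) - c).toENNReal ∂μ ≤ ENNReal.ofReal (I - c * μ.real univ) := by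
    refine lintegral_le_of_tendsto_tailAvg (f := fun t z => (f t z - c).toENNReal) hp ?_ ?_ hy hw
      (fun j => ((hfm j).sub_const _).ereal_toENNReal) hwm hR ?_
    · filter_upwards [hf] with t ht w using lowerSemicontinuous_toENNReal_sub ht c _
    · filter_upwards [hconv] with t ht
      exact convex_epigraph_toENNReal_sub (f := fun w => f t (y₀ t, w)) ht c
    · filter_upwards [hI] with j hj
      rw [lintegral_toENNReal_sub (hcy j) (hfin j) (hint j)]
      exact ENNReal.ofReal_le_ofReal (sub_le_sub_right hj _)
  obtain ⟨hfin₀, hint₀⟩ := integrable_toReal_of_lintegral_toENNReal_sub_ne_top hf₀m hcy₀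
    (hle.trans_lt ENNReal.ofReal_lt_top).ne
  refine ⟨hfin₀, hint₀, ?_⟩
  have hcI : c * μ.real univ ≤ I := by
    obtain ⟨j, hj⟩ := hI.exists
    refine le_trans ?_ hj
    rw [mul_comm, ← smul_eq_mul, ← integral_const]
    refine integral_mono_ae (integrable_const c) (hint j) ?_
    filter_upwards [hcy j, hfin j] with t ht ht'
    exact EReal.coe_le_coe_iff.1 (ht.trans_eq (EReal.coe_toReal ht'.1 ht'.2).symm)
  rw [lintegral_toENNReal_sub hcy₀ hfin₀ hint₀,
    ENNReal.ofReal_le_ofReal_iff (sub_nonneg.2 hcI)] at hle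
  linarith

/-- Approximating the time by simple functions with values in the good times reduces the claim to
the Borel measurability of the lower semicontinuous functions `f s`. -/
theorem aemeasurable_superposition {Z : Type*} [TopologicalSpace Z] [MeasurableSpace Z]
    [OpensMeasurableSpace Z] {μ : Measure ℝ} {S : Set ℝ} (hS : ∀ᵐ t ∂μ, t ∈ S)
    {f : ℝ → Z → EReal} (hf : ∀ᵐ t ∂μ, LowerSemicontinuous (f t))
    (hcont : ∀ᵐ t ∂μ, ∀ z, ContinuousWithinAt (fun s => f s z) S t) {z : ℝ → Z}
    (hz : AEMeasurable z μ) : AEMeasurable (fun t => f t (z t)) μ := by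
  classical
  set G : Set ℝ := {t | t ∈ S ∧ LowerSemicontinuous (f t) ∧
    ∀ z, ContinuousWithinAt (fun s => f s z) S t}
  have hG : ∀ᵐ t ∂μ, t ∈ G := hS.and (hf.and hcont)
  rcases G.eq_empty_or_nonempty with hemp | ⟨t₀, ht₀⟩
  · have hμ : μ = 0 := ae_eq_bot.1 (eventually_false_iff_eq_bot.1
      (by simpa only [hemp, mem_empty_iff_false] using hG))
    rw [hμ]
    exact aemeasurable_zero_measure
  set F : ℝ → Z → EReal := fun b => if b ∈ G then f b else fun _ => 0
  have hFm (b : ℝ) : Measurable (F b) := by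
    by_cases hb : b ∈ G
    · simpa only [F, if_pos hb] using hb.2.1.measurable
    · simpa only [F, if_neg hb] using measurable_const
  set s := fun n => SimpleFunc.approxOn (id : ℝ → ℝ) measurable_id G t₀ ht₀ n
  have hs (n : ℕ) (t : ℝ) : s n t ∈ G := SimpleFunc.approxOn_mem measurable_id ht₀ n t
  suffices AEMeasurable (fun t => f t (hz.mk z t)) μ from
    this.congr (hz.ae_eq_mk.mono fun t ht => by simp only [ht])
  refine aemeasurable_of_tendsto_metrizable_ae atTop (f := fun n t => F (s n t) (hz.mk z t))
    (fun n => ((s n).measurable_bind (fun b t => F b (hz.mk z t)) fun b =>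
      (hFm b).comp hz.measurable_mk).aemeasurable) ?_
  filter_upwards [hG] with t ht
  have hst : Tendsto (fun n => s n t) atTop (𝓝[S] t) :=
    tendsto_nhdsWithin_iff.2 ⟨SimpleFunc.tendsto_approxOn measurable_id ht₀ (subset_closure ht),
      .of_forall fun n => (hs n t).1⟩
  simpa only [F, if_pos (hs _ t), Function.comp_def] using (ht.2.2 (hz.mk z t)).tendsto.comp hst

end ExtendedIntegrands

/-! ### Functions of class `W^{1,2}` -/

instance (T : ℝ) : IsFiniteMeasure (leb T) := by unfold leb; infer_instance

theorem ae_leb_mem (T : ℝ) : ∀ᵐ t ∂(leb T), t ∈ Icc 0 T := ae_restrict_mem measurableSet_Icc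

theorem ae_leb_mem_Ioo (T : ℝ) : ∀ᵐ t ∂(leb T), t ∈ Ioo 0 T := by
  unfold leb
  rw [← restrict_Ioo_eq_restrict_Icc]
  exact ae_restrict_mem measurableSet_Ioo

section W12

variable {F G : Type*} [NormedAddCommGroup F] [NormedSpace ℝ F] [NormedAddCommGroup G]
  [NormedSpace ℝ G] {T : ℝ} {f v : ℝ → F}

/-- `f ∈ W^{1,2}([0,T]; F)` with weak derivative `v`, which is determined up to a null set. -/
structure HasW12Deriv (T : ℝ) (f v : ℝ → F) : Prop where
  memLp : MemLp v 2 (leb T)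
  eq_integral : ∀ t ∈ Icc (0 : ℝ) T, f t = f 0 + ∫ s in (0 : ℝ)..t, v s

theorem intervalIntegrable_of_memLp {F : Type*} [NormedAddCommGroup F] {v : ℝ → F}
    (hv : MemLp v 2 (leb T)) {s t : ℝ} (hs : s ∈ Icc 0 T) (ht : t ∈ Icc 0 T) :
    IntervalIntegrable v volume s t :=
  have hint : IntegrableOn v (Icc 0 T) := hv.integrable one_le_two
  (hint.mono_set (uIcc_subset_Icc hs ht)).intervalIntegrable

theorem integral_congr_leb {w : ℝ → F} (h : v =ᵐ[leb T] w) {t : ℝ} (ht : t ∈ Icc 0 T) :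
    ∫ s in (0 : ℝ)..t, v s = ∫ s in (0 : ℝ)..t, w s := by
  refine intervalIntegral.integral_congr_ae ?_
  filter_upwards [(ae_restrict_iff' measurableSet_Icc).1 h] with s hs hst
  rw [uIoc_of_le ht.1] at hst
  exact hs ⟨hst.1.le, hst.2.trans ht.2⟩

namespace HasW12Deriv

theorem isW12 (h : HasW12Deriv T f v) : IsW12 T f := ⟨v, h.memLp, h.eq_integral⟩

theorem ae_hasDerivAt [CompleteSpace F] (h : HasW12Deriv T f v) :
    ∀ᵐ t ∂(leb T), HasDerivAt f (v t) t := by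
  rcases le_or_gt T 0 with hT | hT
  · filter_upwards [ae_leb_mem_Ioo T] with t ht using absurd (ht.1.trans ht.2) hT.not_gt
  have h0 : (0 : ℝ) ∈ Icc 0 T := ⟨le_rfl, hT.le⟩
  have hint := (intervalIntegrable_of_memLp h.memLp h0 ⟨hT.le, le_rfl⟩).ae_hasDerivAt_integral
  rw [uIcc_of_le hT.le] at hint
  filter_upwards [ae_leb_mem_Ioo T, ae_restrict_of_ae (s := Icc 0 T) hint] with t ht hd
  refine ((hd (Ioo_subset_Icc_self ht) 0 h0).const_add (f 0)).congr_of_eventuallyEq ?_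
  filter_upwards [Ioo_mem_nhds ht.1 ht.2] with s hs
    using h.eq_integral s (Ioo_subset_Icc_self hs)

theorem deriv_ae_eq [CompleteSpace F] (h : HasW12Deriv T f v) : deriv f =ᵐ[leb T] v := by
  filter_upwards [h.ae_hasDerivAt] with t ht using ht.deriv

theorem congr_deriv {w : ℝ → F} (h : HasW12Deriv T f v) (hvw : v =ᵐ[leb T] w) :
    HasW12Deriv T f w :=
  ⟨h.memLp.ae_eq hvw, fun t ht => by rw [h.eq_integral t ht, integral_congr_leb hvw ht]⟩

theorem clm_comp [CompleteSpace F] [CompleteSpace G] (A : F →L[ℝ] G) (h : HasW12Deriv T f v) :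
    HasW12Deriv T (fun t => A (f t)) fun t => A (v t) where
  memLp := A.comp_memLp' h.memLp
  eq_integral t ht := by
    rw [h.eq_integral t ht, map_add, A.intervalIntegral_comp_comm
      (intervalIntegrable_of_memLp h.memLp ⟨le_rfl, ht.1.trans ht.2⟩ ht)]

theorem prodMk [CompleteSpace F] [CompleteSpace G] {g w : ℝ → G} (hf : HasW12Deriv T f v)
    (hg : HasW12Deriv T g w) : HasW12Deriv T (fun t => (f t, g t)) fun t => (v t, w t) := by
  have hvw : MemLp (fun t => (v t, w t)) 2 (leb T) := .of_fst_snd ⟨hf.memLp, hg.memLp⟩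
  refine ⟨hvw, fun t ht => ?_⟩
  have hint := intervalIntegrable_of_memLp hvw ⟨le_rfl, ht.1.trans ht.2⟩ ht
  refine Prod.ext ((hf.eq_integral t ht).trans ?_) ((hg.eq_integral t ht).trans ?_)
  · exact congrArg (f 0 + ·) ((ContinuousLinearMap.fst ℝ F G).intervalIntegral_comp_comm hint)
  · exact congrArg (g 0 + ·) ((ContinuousLinearMap.snd ℝ F G).intervalIntegral_comp_comm hint)

theorem pi [CompleteSpace F] {ι : Type*} [Fintype ι] {f v : ι → ℝ → F}
    (h : ∀ i, HasW12Deriv T (f i) (v i)) : HasW12Deriv T (fun t i => f i t) fun t i => v i t := by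
  have hv : MemLp (fun t i => v i t) 2 (leb T) := .of_eval fun i => (h i).memLp
  refine ⟨hv, fun t ht => funext fun i => ((h i).eq_integral t ht).trans ?_⟩
  have hint := intervalIntegrable_of_memLp hv ⟨le_rfl, ht.1.trans ht.2⟩ ht
  exact congrArg (f i 0 + ·)
    ((ContinuousLinearMap.proj (R := ℝ) (φ := fun _ : ι => F) i).intervalIntegral_comp_comm hint)

theorem tailAvg {f v : ℕ → ℝ → F} (h : ∀ j, HasW12Deriv T (f j) (v j)) (p : ℕ → ℕ →₀ ℝ≥0) (N : ℕ) :
    HasW12Deriv T (fun t => tailAvg p (fun j => f j t) N)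
      fun t => tailAvg p (fun j => v j t) N := by
  refine ⟨memLp_finsetSum _ fun j _ => (h j).memLp.const_smul (p N j : ℝ), fun t ht => ?_⟩
  have hint : ∀ j, IntervalIntegrable (fun s => p N j • v j s) volume 0 t := fun j =>
    (intervalIntegrable_of_memLp (h j).memLp ⟨le_rfl, ht.1.trans ht.2⟩ ht).smul (p N j : ℝ)
  simp only [Sweeping.tailAvg]
  rw [intervalIntegral.integral_finsetSum fun j _ => hint j, ← Finset.sum_add_distrib]
  refine Finset.sum_congr rfl fun j _ => ?_
  simp only [NNReal.smul_def]
  rw [(h j).eq_integral t ht, smul_add, intervalIntegral.integral_smul]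

theorem norm_sub_le (h : HasW12Deriv T f v) {R : ℝ≥0} (hR : eLpNorm v 2 (leb T) ≤ R) {s t : ℝ}
    (hs : s ∈ Icc 0 T) (ht : t ∈ Icc 0 T) : ‖f t - f s‖ ≤ R * √|t - s| := by
  wlog hst : s ≤ t generalizing s t
  · rw [norm_sub_rev, abs_sub_comm]; exact this ht hs (le_of_not_ge hst)
  have h0 : (0 : ℝ) ∈ Icc 0 T := ⟨le_rfl, hs.1.trans hs.2⟩
  have hle : volume.restrict (Ioc s t) ≤ leb T :=
    Measure.restrict_mono (Ioc_subset_Icc_self.trans (Icc_subset_Icc hs.1 ht.2)) le_rfl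
  have heq : f t - f s = ∫ r in Ioc s t, v r := by
    rw [h.eq_integral t ht, h.eq_integral s hs, add_sub_add_left_eq_sub,
      intervalIntegral.integral_interval_sub_left (intervalIntegrable_of_memLp h.memLp h0 ht)
        (intervalIntegrable_of_memLp h.memLp h0 hs), intervalIntegral.integral_of_le hst]
  have hholder : ‖f t - f s‖ₑ ≤ ENNReal.ofReal (R * √|t - s|) := by
    calc ‖f t - f s‖ₑ ≤ ∫⁻ r in Ioc s t, ‖v r‖ₑ := by
          rw [heq]; exact enorm_integral_le_lintegral_enorm _
      _ = eLpNorm v 1 (volume.restrict (Ioc s t)) := eLpNorm_one_eq_lintegral_enorm.symm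
      _ ≤ eLpNorm v 2 (volume.restrict (Ioc s t)) *
          (volume.restrict (Ioc s t)) univ ^ (1 / (1 : ℝ≥0∞).toReal - 1 / (2 : ℝ≥0∞).toReal) :=
          eLpNorm_le_eLpNorm_mul_rpow_measure_univ one_le_two (h.memLp.1.mono_measure hle)
      _ ≤ R * ENNReal.ofReal √|t - s| := by
          gcongr
          · exact (eLpNorm_mono_measure v hle).trans hR
          · rw [Measure.restrict_apply_univ, Real.volume_Ioc, abs_of_nonneg (sub_nonneg.2 hst),
              Real.sqrt_eq_rpow, ENNReal.ofReal_rpow_of_nonneg (sub_nonneg.2 hst) (by norm_num)]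
            norm_num
      _ = ENNReal.ofReal (R * √|t - s|) := by
          rw [ENNReal.ofReal_mul R.coe_nonneg, ENNReal.ofReal_coe_nnreal]
  rw [← ofReal_norm] at hholder
  exact (ENNReal.ofReal_le_ofReal_iff (by positivity)).1 hholder

theorem continuousOn (h : HasW12Deriv T f v) : ContinuousOn f (Icc 0 T) := by
  rcases lt_or_ge T 0 with hT | hT
  · simp only [Icc_eq_empty_of_lt hT, continuousOn_empty]
  have hv : IntegrableOn v (uIcc 0 T) := by
    rw [uIcc_of_le hT]; exact h.memLp.integrable one_le_two
  have hprim := intervalIntegral.continuousOn_primitive_interval hv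
  rw [uIcc_of_le hT] at hprim
  exact (continuousOn_const.add hprim).congr h.eq_integral

theorem aestronglyMeasurable (h : HasW12Deriv T f v) : AEStronglyMeasurable f (leb T) :=
  h.continuousOn.aestronglyMeasurable_of_isCompact isCompact_Icc measurableSet_Icc

theorem of_tendsto {f v : ℕ → ℝ → F} (h : ∀ N, HasW12Deriv T (f N) (v N)) {g v₀ : ℝ → F}
    (hf : ∀ t ∈ Icc 0 T, Tendsto (fun N => f N t) atTop (𝓝 (g t))) (hv₀ : MemLp v₀ 2 (leb T))
    (hv : Tendsto (fun N => eLpNorm (fun t => v N t - v₀ t) 2 (leb T)) atTop (𝓝 0)) :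
    HasW12Deriv T g v₀ := by
  refine ⟨hv₀, fun t ht => ?_⟩
  have hle : volume.restrict (Ioc 0 t) ≤ leb T :=
    Measure.restrict_mono (Ioc_subset_Icc_self.trans (Icc_subset_Icc_right ht.2)) le_rfl
  have hv₁ : Tendsto (fun N => eLpNorm (v N - v₀) 1 (volume.restrict (Ioc 0 t))) atTop (𝓝 0) := by
    have hbd := ENNReal.Tendsto.mul_const (b := (volume.restrict (Ioc 0 t)) univ ^
      (1 / (1 : ℝ≥0∞).toReal - 1 / (2 : ℝ≥0∞).toReal)) hv
      (.inr (ENNReal.rpow_ne_top_of_nonneg (by norm_num) (measure_ne_top _ _)))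
    rw [zero_mul] at hbd
    refine tendsto_of_tendsto_of_tendsto_of_le_of_le tendsto_const_nhds hbd (fun _ => zero_le)
      fun N => ?_
    have hm : MemLp (v N - v₀) 2 (leb T) := (h N).memLp.sub hv₀
    refine (eLpNorm_le_eLpNorm_mul_rpow_measure_univ one_le_two (hm.1.mono_measure hle)).trans ?_
    gcongr
    exact eLpNorm_mono_measure _ hle
  have hint := tendsto_integral_of_L1' v₀
    (intervalIntegrable_of_memLp hv₀ ⟨le_rfl, ht.1.trans ht.2⟩ ht).1.1
    (.of_forall fun N =>
      (intervalIntegrable_of_memLp (h N).memLp ⟨le_rfl, ht.1.trans ht.2⟩ ht).1) hv₁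
  simp only [← intervalIntegral.integral_of_le ht.1] at hint
  refine tendsto_nhds_unique (hf t ht) (((hf 0 ⟨le_rfl, ht.1.trans ht.2⟩).add hint).congr
    fun N => ((h N).eq_integral t ht).symm)

end HasW12Deriv

theorem IsW12.hasW12Deriv [CompleteSpace F] (h : IsW12 T f) : HasW12Deriv T f (deriv f) := by
  obtain ⟨v, hv, hfv⟩ := h
  have hf : HasW12Deriv T f v := ⟨hv, hfv⟩
  exact hf.congr_deriv hf.deriv_ae_eq.symm

/-- A consequence of the Arzelà–Ascoli theorem: the functions have a common modulus of Hölder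
continuity. -/
theorem exists_subseq_tendsto_of_hasW12Deriv [FiniteDimensional ℝ F] (hT : 0 ≤ T)
    {f v : ℕ → ℝ → F} (hf : ∀ k, HasW12Deriv T (f k) (v k)) {y : F} (h0 : ∀ k, f k 0 = y)
    {R : ℝ≥0} (hR : ∀ k, eLpNorm (v k) 2 (leb T) ≤ R) :
    ∃ φ : ℕ → ℕ, StrictMono φ ∧ ∃ g : ℝ → F,
      ∀ t ∈ Icc 0 T, Tendsto (fun k => f (φ k) t) atTop (𝓝 (g t)) := by
  have hmod : Tendsto (fun r : ℝ => R * √|r|) (𝓝 0) (𝓝 0) := by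
    have hc : Continuous fun r : ℝ => R * √|r| := by fun_prop
    simpa using hc.tendsto 0
  have hdist : ∀ k (s t : Icc (0 : ℝ) T), dist (f k s) (f k t) ≤ R * √|dist s t| := fun k s t => by
    rw [abs_of_nonneg dist_nonneg, Subtype.dist_eq, Real.dist_eq, dist_eq_norm]
    exact (hf k).norm_sub_le (hR k) t.2 s.2
  let B : ℕ → BoundedContinuousFunction (Icc (0 : ℝ) T) F := fun k =>
    .mkOfCompact ⟨fun t => f k t, (hf k).continuousOn.domRestrict⟩
  have hB : IsCompact (closure (range B)) := by
    refine BoundedContinuousFunction.arzela_ascoli (Metric.closedBall y (R * √|T|))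
      (ProperSpace.isCompact_closedBall _ _) _ ?_ ?_
    · rintro _ t ⟨k, rfl⟩
      rw [Metric.mem_closedBall, ← h0 k]
      refine (hdist k t ⟨0, le_rfl, hT⟩).trans ?_
      gcongr 2
      rw [Subtype.dist_eq, Real.dist_eq, abs_abs]
      exact abs_le_abs_of_nonneg (by simpa using t.2.1) (by simpa using t.2.2)
    · refine Metric.equicontinuous_of_continuity_modulus _ hmod _ ?_
      rintro s t ⟨_, k, rfl⟩
      exact hdist k s t
  obtain ⟨g, -, φ, hφ, hg⟩ := hB.tendsto_subseq fun k => subset_closure (mem_range_self (f := B) k)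
  refine ⟨φ, hφ, IccExtend hT g, fun t ht => ?_⟩
  rw [IccExtend_of_mem hT g ht]
  exact (BoundedContinuousFunction.tendsto_iff_tendstoUniformly.1 hg).tendsto_at ⟨t, ht⟩

end W12

/-! ### Closed graphs with convex values -/

section LinearImages

variable {W V : Type*} [NormedAddCommGroup W] [NormedSpace ℝ W] [NormedAddCommGroup V]
  [NormedSpace ℝ V] {p : ℕ → ℕ →₀ ℝ≥0} {w : ℕ → W} {w₀ : W}

theorem tendsto_tailAvg_map (A : W →L[ℝ] V) (hw : Tendsto (tailAvg p w) atTop (𝓝 w₀)) :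
    Tendsto (tailAvg p fun j => A (w j)) atTop (𝓝 (A w₀)) :=
  ((A.continuous.tendsto w₀).comp hw).congr (map_tailAvg A.toLinearMap w)

theorem norm_map_le_of_tendsto_tailAvg (hp : IsTailWeights p) (A : W →L[ℝ] V)
    (hw : Tendsto (tailAvg p w) atTop (𝓝 w₀)) {K : ℝ} (hK : ∀ j, ‖A (w j)‖ ≤ K) : ‖A w₀‖ ≤ K :=
  mem_closedBall_zero_iff.1 <| Metric.isClosed_closedBall.mem_of_tendsto (tendsto_tailAvg_map A hw)
    (.of_forall fun _ => hp.tailAvg_mem (convex_closedBall 0 K) fun j _ =>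
      mem_closedBall_zero_iff.2 (hK j))

theorem map_mem_of_tendsto_tailAvg {Y : Type*} [TopologicalSpace Y] [FiniteDimensional ℝ W]
    (hp : IsTailWeights p) (A : W →L[ℝ] V) {Γ : Set (Y × V)} {y : ℕ → Y} {y₀ : Y}
    (hΓ : ∀ v, (y₀, v) ∈ closure Γ → (y₀, v) ∈ Γ) (hconv : Convex ℝ {v | (y₀, v) ∈ Γ})
    (hy : Tendsto y atTop (𝓝 y₀)) (hw : Tendsto (tailAvg p w) atTop (𝓝 w₀))
    (hmem : ∀ j, (y j, A (w j)) ∈ Γ) (hbdd : liminf (tailAvg p fun j => ‖w j‖ₑ ^ 2) atTop < ⊤) :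
    (y₀, A w₀) ∈ Γ := by
  have hA : Continuous (Prod.map id A : Y × W → Y × V) := by fun_prop
  exact mem_of_tendsto_tailAvg (Γ := Prod.map id A ⁻¹' Γ) hp
    (fun w hw => hΓ (A w) (hA.closure_preimage_subset Γ hw))
    (hconv.linear_preimage A.toLinearMap) hy hw hmem hbdd

end LinearImages

section VelocitySets

variable {X V F : Type*} [TopologicalSpace X] [TopologicalSpace F]
  {U : Set V} {g : X → V → F}

theorem isClosed_graph_image [TopologicalSpace V] [T2Space F] (hU : IsCompact U)
    (hg : ContinuousOn (Function.uncurry g) (univ ×ˢ U)) :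
    IsClosed {z : X × F | z.2 ∈ g z.1 '' U} := by
  have : CompactSpace U := isCompact_iff_compactSpace.1 hU
  have hgU : Continuous fun r : (X × F) × U => g r.1.1 r.2 :=
    hg.comp_continuous (f := fun r : (X × F) × U => (r.1.1, (r.2 : V))) (by fun_prop)
      fun r => ⟨mem_univ _, r.2.2⟩
  convert isClosedMap_fst_of_compactSpace (Y := U) _
    (isClosed_eq hgU (continuous_fst.snd : Continuous fun r : (X × F) × U => r.1.2)) using 1
  ext z
  simp [mem_image]

theorem convex_image_of_tendsto [AddCommGroup F] [Module ℝ F] [ContinuousAdd F]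
    [ContinuousConstSMul ℝ F] (hg : ∀ u ∈ U, Continuous fun x => g x u)
    (hcl : IsClosed {z : X × F | z.2 ∈ g z.1 '' U}) {x : ℕ → X} {x₀ : X}
    (hx : Tendsto x atTop (𝓝 x₀)) (hconv : ∀ k, Convex ℝ (g (x k) '' U)) :
    Convex ℝ (g x₀ '' U) := by
  rintro _ ⟨u₁, hu₁, rfl⟩ _ ⟨u₂, hu₂, rfl⟩ s t hs ht hst
  have hlim (u : V) (hu : u ∈ U) : Tendsto (fun k => g (x k) u) atTop (𝓝 (g x₀ u)) :=
    ((hg u hu).tendsto x₀).comp hx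
  exact hcl.mem_of_tendsto
    (hx.prodMk_nhds (((hlim u₁ hu₁).const_smul s).add ((hlim u₂ hu₂).const_smul t)))
    (.of_forall fun k =>
      hconv k (mem_image_of_mem _ hu₁) (mem_image_of_mem _ hu₂) hs ht hst)

end VelocitySets

section NormalCone

variable {n m : ℕ}

theorem convex_normalCone (x : E n) (C : Set (E n)) : Convex ℝ (normalCone x C) := by
  rintro ζ₁ ⟨hx, h₁⟩ ζ₂ ⟨-, h₂⟩ s t hs ht -
  refine ⟨hx, fun y hy => ?_⟩
  rw [inner_add_left, real_inner_smul_left, real_inner_smul_left]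
  exact add_nonpos (mul_nonpos_of_nonneg_of_nonpos hs (h₁ y hy))
    (mul_nonpos_of_nonneg_of_nonpos ht (h₂ y hy))

/-- Moving a point of the polyhedron slightly towards a strict one makes it strict. -/
theorem mem_normalCone_polyhedron_of_strict {a : Fin m → E n} {b : Fin m → ℝ} {x ζ z : E n}
    (hz : ∀ i, inner ℝ (a i) z < b i) (hx : x ∈ polyhedron a b)
    (h : ∀ y, (∀ i, inner ℝ (a i) y < b i) → inner ℝ ζ (y - x) ≤ 0) :
    ζ ∈ normalCone x (polyhedron a b) := by
  refine ⟨hx, fun y hy => ?_⟩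
  have hlim : Tendsto (fun s : ℝ => inner ℝ ζ (y + s • (z - y) - x)) (𝓝[>] 0)
      (𝓝 (inner ℝ ζ (y - x))) := by
    have hc : Continuous fun s : ℝ => inner ℝ ζ (y + s • (z - y) - x) := by fun_prop
    exact tendsto_nhdsWithin_of_tendsto_nhds (by simpa using hc.tendsto 0)
  refine le_of_tendsto hlim ?_
  filter_upwards [Ioo_mem_nhdsGT (zero_lt_one' ℝ)] with s hs
  refine h _ fun i => ?_
  rw [inner_add_right, real_inner_smul_right, inner_sub_right]
  nlinarith [hs.1, hs.2, hy i, hz i]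

theorem mem_normalCone_of_mem_closure_graph {y : State n m} {ζ z : E n}
    (hz : ∀ i, inner ℝ (y.2.1 i) z < y.2.2 i)
    (h : (y, ζ) ∈ closure {r : State n m × E n |
      r.2 ∈ normalCone r.1.1 (polyhedron r.1.2.1 r.1.2.2)}) :
    ζ ∈ normalCone y.1 (polyhedron y.2.1 y.2.2) := by
  set Γ := {r : State n m × E n | r.2 ∈ normalCone r.1.1 (polyhedron r.1.2.1 r.1.2.2)}
  have : (𝓝[Γ] (y, ζ)).NeBot := mem_closure_iff_nhdsWithin_neBot.1 h
  have hΓ : ∀ᶠ r in 𝓝[Γ] (y, ζ), r ∈ Γ := self_mem_nhdsWithin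
  have hlim {φ : State n m × E n → ℝ} (hφ : Continuous φ) :
      Tendsto φ (𝓝[Γ] (y, ζ)) (𝓝 (φ (y, ζ))) := hφ.continuousAt.mono_left nhdsWithin_le_nhds
  refine mem_normalCone_polyhedron_of_strict hz (fun i => ?_) fun y' hy' => ?_
  · exact le_of_tendsto_of_tendsto (hlim (φ := fun r => inner ℝ (r.1.2.1 i) r.1.1) (by fun_prop))
      (hlim (φ := fun r => r.1.2.2 i) (by fun_prop)) (hΓ.mono fun r hr => hr.1 i)
  · have hstrict : ∀ᶠ r in 𝓝[Γ] (y, ζ), y' ∈ polyhedron r.1.2.1 r.1.2.2 :=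
      eventually_all.2 fun i =>
        ((hlim (φ := fun r => inner ℝ (r.1.2.1 i) y') (by fun_prop)).eventually_lt
          (hlim (φ := fun r => r.1.2.2 i) (by fun_prop)) (hy' i)).mono fun _ => le_of_lt
    exact le_of_tendsto (hlim (φ := fun r => inner ℝ r.2 (y' - r.1.1)) (by fun_prop))
      (hΓ.mp (hstrict.mono fun r hr' hr => hr.2 y' hr'))

/-- Slater's condition at the limit gives the graph of the normal cone mapping its closedness. -/
theorem map_mem_normalCone_of_tendsto_tailAvg {W : Type*} [NormedAddCommGroup W]
    [NormedSpace ℝ W] [FiniteDimensional ℝ W] {p : ℕ → ℕ →₀ ℝ≥0} (hp : IsTailWeights p)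
    (A : W →L[ℝ] E n) {w : ℕ → W} {w₀ : W} {y : ℕ → State n m} {y₀ : State n m} {z : E n}
    (hz : ∀ i, inner ℝ (y₀.2.1 i) z < y₀.2.2 i) (hy : Tendsto y atTop (𝓝 y₀))
    (hw : Tendsto (tailAvg p w) atTop (𝓝 w₀))
    (hmem : ∀ j, A (w j) ∈ normalCone (y j).1 (polyhedron (y j).2.1 (y j).2.2))
    (hbdd : liminf (tailAvg p fun j => ‖w j‖ₑ ^ 2) atTop < ⊤) :
    A w₀ ∈ normalCone y₀.1 (polyhedron y₀.2.1 y₀.2.2) :=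
  map_mem_of_tendsto_tailAvg hp A
    (Γ := {r : State n m × E n | r.2 ∈ normalCone r.1.1 (polyhedron r.1.2.1 r.1.2.2)})
    (fun _ => mem_normalCone_of_mem_closure_graph hz)
    (convex_normalCone y₀.1 (polyhedron y₀.2.1 y₀.2.2)) hy hw hmem hbdd

end NormalCone

/-! ### Feasible quadruples -/

section Projections

variable {n m : ℕ}

/-- The projection `(x, a, b) ↦ x`. -/
def projX (n m : ℕ) : State n m →L[ℝ] E n := .fst ℝ _ _

/-- The projection `(x, a, b) ↦ a i`. -/
def projA (n : ℕ) {m : ℕ} (i : Fin m) : State n m →L[ℝ] E n :=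
  (ContinuousLinearMap.proj (R := ℝ) (φ := fun _ : Fin m => E n) i).comp
    ((ContinuousLinearMap.fst ℝ _ _).comp (.snd ℝ (E n) ((Fin m → E n) × (Fin m → ℝ))))

/-- The projection `(x, a, b) ↦ b i`. -/
def projB (n : ℕ) {m : ℕ} (i : Fin m) : State n m →L[ℝ] ℝ :=
  (ContinuousLinearMap.proj (R := ℝ) (φ := fun _ : Fin m => ℝ) i).comp
    ((ContinuousLinearMap.snd ℝ _ _).comp (.snd ℝ (E n) ((Fin m → E n) × (Fin m → ℝ))))

end Projections

namespace Quadruple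

variable {n m d : ℕ}

/-- The quadruple with state `(x, a, b) = y` and control `u`. -/
def ofPos (y : ℝ → State n m) (u : ℝ → E d) : Quadruple n m d :=
  ⟨fun t => projX n m (y t), fun i t => projA n i (y t), fun i t => projB n i (y t), u⟩

theorem ofPos_vel {y : ℝ → State n m} {u : ℝ → E d} {w : State n m} {t : ℝ}
    (h : HasDerivAt y w t) : (ofPos y u).vel t = w :=
  Prod.ext ((projX n m).hasFDerivAt.comp_hasDerivAt t h).deriv <|
    Prod.ext (funext fun i => ((projA n i).hasFDerivAt.comp_hasDerivAt t h).deriv)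
      (funext fun i => ((projB n i).hasFDerivAt.comp_hasDerivAt t h).deriv)

end Quadruple

namespace Problem

variable {n m d : ℕ} {P : Problem n m d} {q : Quadruple n m d}

/-- The initial value of the state `(x, a, b)`. -/
def init (P : Problem n m d) : State n m := (P.x₀, P.a₀, P.b₀)

/-- The velocities `(ẋ, ȧ, ḃ)` along a quadruple, together with the perturbation `g(x, u)`. The
perturbation is carried along so that one sequence of convex combinations serves both. -/
noncomputable def augmentedVel (P : Problem n m d) (q : Quadruple n m d) (t : ℝ) :
    State n m × E n :=
  (q.vel t, P.g (q.x t) (q.u t))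

/-- The running cost as a function of time and of the pair of state and velocity, for a cost that
does not depend on the control; the value `0` of the control is arbitrary. -/
def stateCost (P : Problem n m d) (t : ℝ) (z : State n m × State n m) : EReal := P.ℓ t z.1 0 z.2

/-- Slater's condition for the moving polyhedron, imposed on all admissible controls `(a, b)`. -/
def SlaterCondition (P : Problem n m d) : Prop :=
  ∀ a b, P.AdmissibleControls a b →
    ∀ t ∈ Icc (0 : ℝ) P.T, ∃ z : E n, ∀ i, inner ℝ (a i t) z < b i t

theorem H4.slaterCondition (h4 : P.H4) : P.SlaterCondition := fun a b hab t ht => by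
  obtain ⟨-, θ, -, ⟨δ, hδ, hθδ⟩, hθ⟩ := h4 a b hab
  obtain ⟨z, hz⟩ := hθ t ht
  exact ⟨z, fun i => sub_neg.1 (((hz i).trans_le (hθδ t ht)).trans hδ)⟩

theorem H3.continuousOn (h3 : P.H3) :
    ContinuousOn (Function.uncurry P.g) (univ ×ˢ P.U) := by
  obtain ⟨⟨L, -, hg⟩, -⟩ := h3
  rintro ⟨x, u⟩ ⟨-, hu⟩
  have hlim : Tendsto (fun z : E n × E d => L * (‖z.1 - x‖ + ‖z.2 - u‖))
      (𝓝[univ ×ˢ P.U] (x, u)) (𝓝 0) := by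
    have hc : Continuous fun z : E n × E d => L * (‖z.1 - x‖ + ‖z.2 - u‖) := by fun_prop
    exact tendsto_nhdsWithin_of_tendsto_nhds (by simpa using hc.tendsto (x, u))
  refine tendsto_iff_norm_sub_tendsto_zero.2 (squeeze_zero' (.of_forall fun _ => norm_nonneg _)
    (eventually_mem_nhdsWithin.mono fun z hz => ?_) hlim)
  exact hg z.1 x z.2 hz.2 u hu

theorem runningCost_ae_eq (hindep : P.CostIndepControl) (q : Quadruple n m d) :
    P.runningCost q =ᵐ[leb P.T] fun t => P.stateCost t (q.pos t, q.vel t) := by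
  filter_upwards [ae_leb_mem P.T] with t ht using hindep t ht _ _ _ _

theorem lowerSemicontinuous_stateCost (h5 : P.H5) :
    ∀ᵐ t ∂(leb P.T), LowerSemicontinuous (P.stateCost t) := by
  filter_upwards [h5.2.2.2.1] with t ht
  exact ht.comp (g := fun z : State n m × State n m => (z.1, (0 : E d), z.2)) (by fun_prop)

theorem aemeasurable_stateCost (h5 : P.H5) {z : ℝ → State n m × State n m}
    (hz : AEMeasurable z (leb P.T)) : AEMeasurable (fun t => P.stateCost t (z t)) (leb P.T) :=
  aemeasurable_superposition (ae_leb_mem P.T) (lowerSemicontinuous_stateCost h5)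
    (h5.2.2.2.2.mono fun _ ht _ => ht _ _ _) hz

namespace Feasible

theorem hasW12Deriv_pos (hq : P.Feasible q) : HasW12Deriv P.T q.pos q.vel :=
  hq.x_w12.hasW12Deriv.prodMk
    ((HasW12Deriv.pi fun i => (hq.controls.a_w12 i).hasW12Deriv).prodMk
      (HasW12Deriv.pi fun i => (hq.controls.b_w12 i).hasW12Deriv))

theorem pos_zero (hq : P.Feasible q) : q.pos 0 = P.init :=
  Prod.ext hq.x_init (Prod.ext (funext hq.controls.a_init) (funext hq.controls.b_init))

theorem perturbation_sub_mem_normalCone (hq : P.Feasible q) :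
    ∀ᵐ t ∂(leb P.T), P.g (q.x t) (q.u t) - deriv q.x t ∈ normalCone (q.x t) (q.C t) := by
  filter_upwards [hq.inclusion] with t ⟨ζ, hζ, h⟩
  rwa [h, neg_add_eq_sub, sub_sub_cancel]

theorem aestronglyMeasurable_augmentedVel (hU : IsClosed P.U)
    (hg : ContinuousOn (Function.uncurry P.g) (univ ×ˢ P.U)) (hq : P.Feasible q) :
    AEStronglyMeasurable (P.augmentedVel q) (leb P.T) := by
  classical
  refine hq.hasW12Deriv_pos.memLp.1.prodMk ?_
  have hm : Measurable ((univ ×ˢ P.U).piecewise (Function.uncurry P.g) 0) :=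
    hg.measurable_piecewise continuousOn_const (MeasurableSet.univ.prod hU.measurableSet)
  have hxu : AEMeasurable (fun t => (q.x t, q.u t)) (leb P.T) :=
    hq.x_w12.hasW12Deriv.aestronglyMeasurable.aemeasurable.prodMk hq.u_l2.1.aemeasurable
  refine ((hm.comp_aemeasurable hxu).congr ?_).aestronglyMeasurable
  filter_upwards [hq.u_mem] with t ht
  exact piecewise_eq_of_mem _ _ _ (show (q.x t, q.u t) ∈ univ ×ˢ P.U from ⟨mem_univ _, ht⟩)

theorem norm_augmentedVel_le (hq : P.Feasible q) {B : ℝ} (hB : 0 ≤ B)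
    (hg : ∀ t ∈ Icc 0 P.T, ∀ u ∈ P.U, ‖P.g (q.x t) u‖ ≤ B) :
    ∀ᵐ t ∂(leb P.T), ‖P.augmentedVel q t‖ ≤ ‖deriv q.x t‖ + (|P.K| + B) := by
  filter_upwards [ae_leb_mem P.T, hq.u_mem, ae_all_iff.2 hq.controls.a_bound,
    ae_all_iff.2 hq.controls.b_bound] with t ht hu ha hb
  have h₀ : 0 ≤ |P.K| + B := add_nonneg (abs_nonneg _) hB
  have hx : 0 ≤ ‖deriv q.x t‖ := norm_nonneg _
  have hK {r : ℝ} (hr : r ≤ P.K) : r ≤ ‖deriv q.x t‖ + (|P.K| + B) := by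
    linarith [le_abs_self P.K]
  refine norm_prod_le_iff.2 ⟨norm_prod_le_iff.2 ⟨?_, norm_prod_le_iff.2 ⟨?_, ?_⟩⟩, ?_⟩
  · exact le_add_of_nonneg_right h₀
  · exact (pi_norm_le_iff_of_nonneg (by positivity)).2 fun i => hK (ha i)
  · exact (pi_norm_le_iff_of_nonneg (by positivity)).2 fun i => hK (hb i)
  · exact (hg t ht _ hu).trans (by linarith [abs_nonneg P.K])

end Feasible

/-- A bound on `ẋ` confines `x(t)` to a compact set, on which the perturbation is bounded. -/
theorem exists_eLpNorm_augmentedVel_le (hU : IsCompact P.U)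
    (hg : ContinuousOn (Function.uncurry P.g) (univ ×ˢ P.U)) (R : ℝ≥0) :
    ∃ R' : ℝ≥0, ∀ q, P.Feasible q → eLpNorm (deriv q.x) 2 (leb P.T) ≤ R →
      eLpNorm (P.augmentedVel q) 2 (leb P.T) ≤ R' := by
  have hK : IsCompact (Metric.closedBall P.x₀ (R * √P.T) ×ˢ P.U) :=
    (isCompact_closedBall _ _).prod hU
  obtain ⟨B, hB, hBg⟩ := (hK.image_of_continuousOn
    (hg.mono (prod_mono_left (subset_univ _)))).isBounded.exists_pos_norm_le
  set R₁ := eLpNorm (fun _ : ℝ => |P.K| + B) 2 (leb P.T)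
  have hR₁ : R₁ ≠ ⊤ := (memLp_const _).2.ne
  refine ⟨R + R₁.toNNReal, fun q hq hR => ?_⟩
  have hbound : ∀ t ∈ Icc 0 P.T, ∀ u ∈ P.U, ‖P.g (q.x t) u‖ ≤ B := fun t ht u hu => by
    refine hBg _ ⟨(q.x t, u), ⟨?_, hu⟩, rfl⟩
    have hx := hq.x_w12.hasW12Deriv.norm_sub_le hR ⟨le_rfl, ht.1.trans ht.2⟩ ht
    rw [sub_zero, hq.x_init, abs_of_nonneg ht.1] at hx
    rw [mem_closedBall_iff_norm]
    exact hx.trans (by gcongr; exact ht.2)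
  have hx := hq.x_w12.hasW12Deriv.memLp.1
  rw [ENNReal.coe_add, ENNReal.coe_toNNReal hR₁]
  calc eLpNorm (P.augmentedVel q) 2 (leb P.T)
      ≤ eLpNorm ((fun t => ‖deriv q.x t‖) + fun _ => |P.K| + B) 2 (leb P.T) :=
        eLpNorm_mono_ae_real (hq.norm_augmentedVel_le hB.le hbound)
    _ ≤ eLpNorm (fun t => ‖deriv q.x t‖) 2 (leb P.T) + R₁ :=
        eLpNorm_add_le hx.norm aestronglyMeasurable_const one_le_two
    _ ≤ R + R₁ := by rw [eLpNorm_norm]; gcongr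

end Problem

/-! ### Limits of minimizing sequences -/

namespace Problem

variable {n m d : ℕ} {P : Problem n m d} {q : ℕ → Quadruple n m d}

theorem eLpNorm_vel_le (q : Quadruple n m d) :
    eLpNorm q.vel 2 (leb P.T) ≤ eLpNorm (P.augmentedVel q) 2 (leb P.T) :=
  eLpNorm_mono fun t => norm_fst_le (P.augmentedVel q t)

/-- `y` is the pointwise limit of the states `(x, a, b)` along the feasible quadruples `q k`, and
`(v, γ)` is the limit, almost everywhere, of the tail averages with weights `p` of the velocities
and the perturbations along `q k`, which are bounded in `L²`. -/
structure MazurLimit (P : Problem n m d) (q : ℕ → Quadruple n m d) (p : ℕ → ℕ →₀ ℝ≥0)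
    (y v : ℝ → State n m) (γ : ℝ → E n) : Prop where
  weights : IsTailWeights p
  feasible : ∀ k, P.Feasible (q k)
  exists_bound : ∃ R : ℝ≥0, ∀ k, eLpNorm (P.augmentedVel (q k)) 2 (leb P.T) ≤ R
  tendsto_pos : ∀ t ∈ Icc 0 P.T, Tendsto (fun k => (q k).pos t) atTop (𝓝 (y t))
  hasW12Deriv : HasW12Deriv P.T y v
  aemeasurable : AEMeasurable γ (leb P.T)
  tendsto_tailAvg : ∀ᵐ t ∂(leb P.T),
    Tendsto (tailAvg p fun k => P.augmentedVel (q k) t) atTop (𝓝 (v t, γ t))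

theorem exists_mazurLimit (hT : 0 ≤ P.T) (hU : IsCompact P.U)
    (hg : ContinuousOn (Function.uncurry P.g) (univ ×ˢ P.U)) (hq : ∀ k, P.Feasible (q k))
    {R : ℝ≥0} (hR : ∀ k, eLpNorm (deriv (q k).x) 2 (leb P.T) ≤ R) :
    ∃ φ : ℕ → ℕ, StrictMono φ ∧ ∃ p y v γ, P.MazurLimit (q ∘ φ) p y v γ := by
  obtain ⟨R', hR'⟩ := exists_eLpNorm_augmentedVel_le hU hg R
  have hbound (k : ℕ) : eLpNorm (P.augmentedVel (q k)) 2 (leb P.T) ≤ R' := hR' _ (hq k) (hR k)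
  obtain ⟨φ, hφ, y, hy⟩ := exists_subseq_tendsto_of_hasW12Deriv hT
    (fun k => (hq k).hasW12Deriv_pos) (fun k => (hq k).pos_zero)
    (fun k => (eLpNorm_vel_le (q k)).trans (hbound k))
  obtain ⟨p, hp, H, hH, hlim, hae⟩ := exists_tailAvg_tendsto_ae
    (f := fun k => P.augmentedVel (q (φ k))) (fun k =>
      ⟨(hq (φ k)).aestronglyMeasurable_augmentedVel hU.isClosed hg,
        (hbound (φ k)).trans_lt ENNReal.coe_lt_top⟩) (fun k => hbound (φ k))
  have hvel : Tendsto (fun N => eLpNorm (fun t => tailAvg p (fun j => (q (φ j)).vel t) N - (H t).1)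
      2 (leb P.T)) atTop (𝓝 0) :=
    tendsto_of_tendsto_of_tendsto_of_le_of_le tendsto_const_nhds hlim (fun _ => zero_le) fun N =>
      eLpNorm_mono fun t => by
        have hfst : tailAvg p (fun j => (q (φ j)).vel t) N =
            (tailAvg p (fun j => P.augmentedVel (q (φ j)) t) N).1 :=
          (fst_tailAvg (fun j => P.augmentedVel (q (φ j)) t) N).symm
        rw [hfst]
        exact norm_fst_le (tailAvg p (fun j => P.augmentedVel (q (φ j)) t) N - H t)
  exact ⟨φ, hφ, p, y, fun t => (H t).1, fun t => (H t).2, hp, fun k => hq (φ k),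
    ⟨R', fun k => hbound (φ k)⟩, hy,
    .of_tendsto (HasW12Deriv.tailAvg (fun j => (hq (φ j)).hasW12Deriv_pos) p)
      (fun t ht => hp.tendsto_tailAvg (hy t ht)) hH.fst hvel, hH.snd.1.aemeasurable, hae⟩

namespace MazurLimit

variable {p : ℕ → ℕ →₀ ℝ≥0} {y v : ℝ → State n m} {γ : ℝ → E n}

theorem tendsto_tailAvg_vel (h : P.MazurLimit q p y v γ) :
    ∀ᵐ t ∂(leb P.T), Tendsto (tailAvg p fun k => (q k).vel t) atTop (𝓝 (v t)) :=
  h.tendsto_tailAvg.mono fun t ht =>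
    tendsto_tailAvg_map (w := fun k => P.augmentedVel (q k) t) (w₀ := (v t, γ t))
      (.fst ℝ (State n m) (E n)) ht

theorem ofPos_vel_ae_eq (h : P.MazurLimit q p y v γ) (u : ℝ → E d) :
    (Quadruple.ofPos y u).vel =ᵐ[leb P.T] v :=
  h.hasW12Deriv.ae_hasDerivAt.mono fun _ ht => Quadruple.ofPos_vel ht

theorem ae_liminf_lt_top (hU : IsClosed P.U)
    (hg : ContinuousOn (Function.uncurry P.g) (univ ×ˢ P.U)) (h : P.MazurLimit q p y v γ) :
    ∀ᵐ t ∂(leb P.T), liminf (tailAvg p fun k => ‖P.augmentedVel (q k) t‖ₑ ^ 2) atTop < ⊤ :=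
  ae_liminf_tailAvg_lt_top h.weights
    (fun k => (h.feasible k).aestronglyMeasurable_augmentedVel hU hg) h.exists_bound.choose_spec

theorem pos_zero (hT : 0 ≤ P.T) (h : P.MazurLimit q p y v γ) : y 0 = P.init :=
  tendsto_nhds_unique (h.tendsto_pos 0 ⟨le_rfl, hT⟩)
    (tendsto_const_nhds.congr fun k => (h.feasible k).pos_zero.symm)

theorem admissibleControls (hT : 0 ≤ P.T) (h : P.MazurLimit q p y v γ) (u : ℝ → E d) :
    P.AdmissibleControls (Quadruple.ofPos y u).a (Quadruple.ofPos y u).b where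
  a_w12 i := (h.hasW12Deriv.clm_comp (projA n i)).isW12
  b_w12 i := (h.hasW12Deriv.clm_comp (projB n i)).isW12
  a_init i := congrArg (projA n i) (h.pos_zero hT)
  b_init i := congrArg (projB n i) (h.pos_zero hT)
  a_bound i := by
    filter_upwards [h.tendsto_tailAvg_vel, (h.hasW12Deriv.clm_comp (projA n i)).deriv_ae_eq,
      ae_all_iff.2 fun k => (h.feasible k).controls.a_bound i] with t hv hd hK
    exact hd ▸ norm_map_le_of_tendsto_tailAvg h.weights (projA n i) hv hK
  b_bound i := by
    filter_upwards [h.tendsto_tailAvg_vel, (h.hasW12Deriv.clm_comp (projB n i)).deriv_ae_eq,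
      ae_all_iff.2 fun k => (h.feasible k).controls.b_bound i] with t hv hd hK
    exact hd ▸ norm_map_le_of_tendsto_tailAvg h.weights (projB n i) hv hK
  a_unit i t ht := tendsto_nhds_unique
    (((projA n i).continuous.tendsto _).comp (h.tendsto_pos t ht)).norm
    (tendsto_const_nhds.congr fun k => ((h.feasible k).controls.a_unit i t ht).symm)

theorem mem_polyhedron (h : P.MazurLimit q p y v γ) {t : ℝ} (ht : t ∈ Icc 0 P.T) :
    (y t).1 ∈ polyhedron (y t).2.1 (y t).2.2 := fun i => by
  have hc : Continuous fun y : State n m => inner ℝ (y.2.1 i) y.1 := by fun_prop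
  exact le_of_tendsto_of_tendsto' ((hc.tendsto _).comp (h.tendsto_pos t ht))
    (((projB n i).continuous.tendsto _).comp (h.tendsto_pos t ht))
    fun k => (h.feasible k).x_mem t ht i

theorem mem_image (hU : IsCompact P.U)
    (hg : ContinuousOn (Function.uncurry P.g) (univ ×ˢ P.U)) (h : P.MazurLimit q p y v γ)
    (hgconv : ∀ k, ∀ᵐ t ∂(leb P.T), Convex ℝ (P.g ((q k).x t) '' P.U)) :
    ∀ᵐ t ∂(leb P.T), γ t ∈ P.g (y t).1 '' P.U := by
  have hcl := isClosed_graph_image hU hg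
  have hgx (u : E d) (hu : u ∈ P.U) : Continuous fun x => P.g x u :=
    hg.comp_continuous (f := fun x => (x, u)) (by fun_prop) fun _ => ⟨mem_univ _, hu⟩
  filter_upwards [ae_leb_mem P.T, h.tendsto_tailAvg, h.ae_liminf_lt_top hU.isClosed hg,
    ae_all_iff.2 hgconv, ae_all_iff.2 fun k => (h.feasible k).u_mem] with t ht hlim hbdd hconv hu
  have hx : Tendsto (fun k => (q k).x t) atTop (𝓝 (y t).1) :=
    ((projX n m).continuous.tendsto _).comp (h.tendsto_pos t ht)
  exact map_mem_of_tendsto_tailAvg h.weights (.snd ℝ (State n m) (E n))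
    (fun _ hw => hcl.closure_subset hw) (convex_image_of_tendsto hgx hcl hx hconv) hx hlim
    (fun k => mem_image_of_mem _ (hu k)) hbdd

theorem exists_control (hU : IsCompact P.U)
    (hg : ContinuousOn (Function.uncurry P.g) (univ ×ˢ P.U)) (h : P.MazurLimit q p y v γ)
    (hgconv : ∀ k, ∀ᵐ t ∂(leb P.T), Convex ℝ (P.g ((q k).x t) '' P.U)) :
    ∃ u, Measurable u ∧ ∀ᵐ t ∂(leb P.T), u t ∈ P.U ∧ P.g (y t).1 (u t) = γ t :=
  exists_measurable_selection_of_mem_image (g := P.g) hU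
    (fun u hu => (hg.comp_continuous (f := fun x => (x, u)) (by fun_prop)
      fun _ => ⟨mem_univ _, hu⟩).measurable)
    (fun x => hg.comp (f := fun u => (x, u)) (by fun_prop) fun _ hu => ⟨mem_univ _, hu⟩)
    (h.hasW12Deriv.clm_comp (projX n m)).aestronglyMeasurable.aemeasurable h.aemeasurable
    (h.mem_image hU hg hgconv)

theorem sub_mem_normalCone (hT : 0 ≤ P.T) (hU : IsClosed P.U)
    (hg : ContinuousOn (Function.uncurry P.g) (univ ×ˢ P.U)) (hS : P.SlaterCondition)
    (h : P.MazurLimit q p y v γ) :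
    ∀ᵐ t ∂(leb P.T), γ t - (v t).1 ∈ normalCone (y t).1 (polyhedron (y t).2.1 (y t).2.2) := by
  filter_upwards [ae_leb_mem P.T, h.tendsto_tailAvg, h.ae_liminf_lt_top hU hg,
    ae_all_iff.2 fun k => (h.feasible k).perturbation_sub_mem_normalCone] with t ht hlim hbdd hmem
  obtain ⟨z, hz⟩ := hS _ _ (h.admissibleControls hT fun _ => 0) t ht
  let A : State n m × E n →L[ℝ] E n :=
    .snd ℝ (State n m) (E n) - (projX n m).comp (.fst ℝ (State n m) (E n))
  have hmem' (k : ℕ) : A (P.augmentedVel (q k) t) ∈ normalCone ((q k).pos t).1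
      (polyhedron ((q k).pos t).2.1 ((q k).pos t).2.2) := hmem k
  have hA : A (v t, γ t) ∈ normalCone (y t).1 (polyhedron (y t).2.1 (y t).2.2) :=
    map_mem_normalCone_of_tendsto_tailAvg h.weights A hz (h.tendsto_pos t ht) hlim hmem' hbdd
  exact hA

theorem cost_ofPos (h5 : P.H5) (hindep : P.CostIndepControl) (hconv : P.CostConvexVel)
    (h : P.MazurLimit q p y v γ) (u : ℝ → E d) {I : ℝ}
    (hI : ∀ᶠ k in atTop, ∫ t, (P.runningCost (q k) t).toReal ∂(leb P.T) ≤ I) :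
    (∀ᵐ t ∂(leb P.T), P.runningCost (.ofPos y u) t ≠ ⊤ ∧ P.runningCost (.ofPos y u) t ≠ ⊥) ∧
      Integrable (fun t => (P.runningCost (.ofPos y u) t).toReal) (leb P.T) ∧
      ∫ t, (P.runningCost (.ofPos y u) t).toReal ∂(leb P.T) ≤ I := by
  obtain ⟨c, hc⟩ := h5.2.2.1
  obtain ⟨R, hR⟩ := h.exists_bound
  have hpos (k : ℕ) := (h.feasible k).hasW12Deriv_pos
  have hrun (k : ℕ) := runningCost_ae_eq hindep (q k)
  have hreal (k : ℕ) : (fun t => (P.runningCost (q k) t).toReal) =ᵐ[leb P.T]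
      fun t => (P.stateCost t ((q k).pos t, (q k).vel t)).toReal :=
    (hrun k).fun_comp EReal.toReal
  have hlimit : P.runningCost (.ofPos y u) =ᵐ[leb P.T] fun t => P.stateCost t (y t, v t) := by
    filter_upwards [runningCost_ae_eq hindep (.ofPos y u), h.ofPos_vel_ae_eq u] with t hrun hvel
    rw [hrun, hvel]
    rfl
  obtain ⟨hfin, hint, hle⟩ := integral_le_of_tendsto_tailAvg h.weights
    (lowerSemicontinuous_stateCost h5) (hc.mono fun t ht z => ht _ _ _)
    (hconv.mono fun t ht => ht (y t) 0) ((ae_leb_mem P.T).mono h.tendsto_pos)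
    h.tendsto_tailAvg_vel
    (fun k => aemeasurable_stateCost h5
      ((hpos k).aestronglyMeasurable.prodMk (hpos k).memLp.1).aemeasurable)
    (aemeasurable_stateCost h5
      (h.hasW12Deriv.aestronglyMeasurable.prodMk h.hasW12Deriv.memLp.1).aemeasurable)
    (fun k => (hpos k).memLp.1) (fun k => (eLpNorm_vel_le (q k)).trans (hR k))
    (fun k => by filter_upwards [hrun k, (h.feasible k).cost_finite] with t ht using ht ▸ id)
    (fun k => (h.feasible k).cost_integrable.congr (hreal k))
    (hI.mono fun k hk => (integral_congr_ae (hreal k)).symm.trans_le hk)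
  have hlimitReal := hlimit.fun_comp EReal.toReal
  exact ⟨by filter_upwards [hlimit, hfin] with t ht using ht ▸ id, hint.congr hlimitReal.symm,
    (integral_congr_ae hlimitReal).trans_le hle⟩

theorem exists_feasible (hT : 0 ≤ P.T) (hU : IsCompact P.U)
    (hg : ContinuousOn (Function.uncurry P.g) (univ ×ˢ P.U)) (hS : P.SlaterCondition)
    (h5 : P.H5) (hindep : P.CostIndepControl) (hconv : P.CostConvexVel)
    (h : P.MazurLimit q p y v γ)
    (hgconv : ∀ k, ∀ᵐ t ∂(leb P.T), Convex ℝ (P.g ((q k).x t) '' P.U)) {I : ℝ}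
    (hI : ∀ᶠ k in atTop, ∫ t, (P.runningCost (q k) t).toReal ∂(leb P.T) ≤ I) :
    ∃ u, P.Feasible (.ofPos y u) := by
  obtain ⟨u, hum, hu⟩ := h.exists_control hU hg hgconv
  obtain ⟨B, hB⟩ := hU.isBounded.exists_norm_le
  obtain ⟨hfin, hint, -⟩ := h.cost_ofPos h5 hindep hconv u hI
  have hx := h.hasW12Deriv.clm_comp (projX n m)
  exact ⟨u,
    { x_w12 := hx.isW12
      controls := h.admissibleControls hT u
      u_l2 := .of_bound hum.aestronglyMeasurable B (hu.mono fun t ht => hB _ ht.1)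
      u_mem := hu.mono fun _ => And.left
      x_init := congrArg (projX n m) (h.pos_zero hT)
      x_mem := fun t => h.mem_polyhedron
      inclusion := by
        filter_upwards [h.sub_mem_normalCone hT hU.isClosed hg hS, hu, hx.deriv_ae_eq]
          with t hζ hut hd
        refine ⟨_, hζ, hd.trans ?_⟩
        change (v t).1 = -(γ t - (v t).1) + P.g (y t).1 (u t)
        rw [hut.2, neg_sub, sub_add_cancel]
      cost_finite := hfin
      cost_integrable := hint }⟩

theorem eventually_integral_le (hT : 0 ≤ P.T) (hφ : LowerSemicontinuous P.φ)
    (h : P.MazurLimit q p y v γ) {β : EReal} (hJ : Tendsto (fun k => P.J (q k)) atTop (𝓝 β))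
    {b M : ℝ} (hb : (b : EReal) < P.φ (y P.T).1) (hM : β < M) :
    ∀ᶠ k in atTop, ∫ t, (P.runningCost (q k) t).toReal ∂(leb P.T) ≤ M - b := by
  have hx : Tendsto (fun k => (q k).x P.T) atTop (𝓝 (y P.T).1) :=
    ((projX n m).continuous.tendsto _).comp (h.tendsto_pos P.T ⟨hT, le_rfl⟩)
  filter_upwards [hx.eventually (hφ _ b hb), hJ.eventually_lt_const hM] with k hbk hMk
  have hsum := (add_le_add_left hbk.le _).trans hMk.le
  rw [← EReal.coe_add, EReal.coe_le_coe_iff] at hsum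
  linarith

theorem J_ofPos_le (hT : 0 ≤ P.T) (h5 : P.H5) (hindep : P.CostIndepControl)
    (hconv : P.CostConvexVel) (h : P.MazurLimit q p y v γ) (u : ℝ → E d) {β : EReal}
    (hJ : Tendsto (fun k => P.J (q k)) atTop (𝓝 β)) : P.J (.ofPos y u) ≤ β := by
  refine EReal.le_of_forall_lt_iff_le.1 fun M hM => ?_
  refine EReal.add_le_of_le_sub (EReal.ge_of_forall_gt_iff_ge.1 fun b hb => ?_)
  have hI := h.eventually_integral_le hT h5.2.1 hJ hb hM
  have hle := (h.cost_ofPos h5 hindep hconv u hI).2.2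
  rw [← EReal.coe_sub, EReal.coe_le_coe_iff]
  linarith

end MazurLimit

end Problem

end Sweeping

theorem theorem3p1_general {n m d : ℕ} (P : Sweeping.Problem n m d) (hT : 0 ≤ P.T)
    (h1 : P.H1) (hg : ContinuousOn (Function.uncurry P.g) (univ ×ˢ P.U))
    (hS : P.SlaterCondition) (h5 : P.H5)
    (hindep : P.CostIndepControl) (hconv : P.CostConvexVel)
    (q : ℕ → Sweeping.Quadruple n m d) (hq : P.IsMinimizingSeq q)
    (hbdd : ∃ R : ℝ≥0, ∀ k, eLpNorm (deriv (q k).x) 2 (Sweeping.leb P.T) ≤ R)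
    (hgconv : ∀ k, ∀ᵐ t ∂(Sweeping.leb P.T), Convex ℝ (P.g ((q k).x t) '' P.U)) :
    ∃ q' : Sweeping.Quadruple n m d, P.IsOptimal q' := by
  have hvalue (q' : Sweeping.Quadruple n m d) (hq' : P.Feasible q') : P.value ≤ P.J q' :=
    iInf_le (fun q : {q // P.Feasible q} => P.J q) ⟨q', hq'⟩
  rcases eq_or_ne P.value ⊤ with htop | htop
  · exact ⟨q 0, hq.1 0, fun q' hq' => le_top.trans (htop.symm.trans_le (hvalue q' hq'))⟩
  have hU : IsCompact P.U := Metric.isCompact_of_isClosed_isBounded h1.1 h1.2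
  obtain ⟨R, hR⟩ := hbdd
  obtain ⟨φ, hφ, p, y, v, γ, hlim⟩ := Sweeping.Problem.exists_mazurLimit hT hU hg hq.1 hR
  have hJ : Tendsto (fun k => P.J (q (φ k))) atTop (𝓝 P.value) := hq.2.comp hφ.tendsto_atTop
  obtain ⟨b, -, hb⟩ := EReal.lt_iff_exists_real_btwn.1 (bot_lt_iff_ne_bot.2 (h5.1 (y P.T).1))
  obtain ⟨M, hM, -⟩ := EReal.lt_iff_exists_real_btwn.1 htop.lt_top
  obtain ⟨u, hu⟩ := hlim.exists_feasible hT hU hg hS h5 hindep hconv (fun k => hgconv (φ k))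
    (hlim.eventually_integral_le hT h5.2.1 hJ hb hM)
  exact ⟨_, hu, fun q' hq' => (hlim.J_ofPos_le hT h5 hindep hconv u hJ).trans (hvalue q' hq')⟩

theorem theorem3p1 {n m d : ℕ} (P : Sweeping.Problem n m d) (hT : 0 < P.T)
    (h1 : P.H1) (h3 : P.H3) (h4 : P.H4) (h5 : P.H5)
    (hindep : P.CostIndepControl) (hconv : P.CostConvexVel)
    (q : ℕ → Sweeping.Quadruple n m d) (hq : P.IsMinimizingSeq q)
    (hmaj : ∃ κ : ℝ → ℝ, Integrable κ (Sweeping.leb P.T) ∧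
      ∀ k, ∀ᵐ t ∂(Sweeping.leb P.T), P.runningCost (q k) t ≤ (κ t : EReal))
    (hbdd : ∃ R : ℝ≥0, ∀ k, Sweeping.w12Norm P.T (q k).x ≤ R ∧
      (∀ i, Sweeping.w12Norm P.T ((q k).a i) ≤ R) ∧ (∀ i, Sweeping.w12Norm P.T ((q k).b i) ≤ R))
    (hgconv : ∀ k, ∀ t ∈ Icc (0 : ℝ) P.T, Convex ℝ (P.g ((q k).x t) '' P.U)) :
    ∃ q' : Sweeping.Quadruple n m d, P.IsOptimal q' :=
  theorem3p1_general P hT.le h1 h3.continuousOn h4.slaterCondition h5 hindep hconv q hq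
    (hbdd.imp fun _ hR k => le_add_self.trans (hR k).1)
    fun k => (Sweeping.ae_leb_mem P.T).mono (hgconv k)
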